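/- Let $T=V/\Lambda$ be a simple complex torus of dimension $g>2$ ($V$ a $g$-dimensional complex vector space, $\Lambda$ a lattice of rank $2g$ in $V$), and write $\Lambda_{\mathbb Q}=\Lambda\otimes\mathbb Q=\mathrm H_1(T,\mathbb Q)$. Suppose that the endomorphism algebra $\mathrm{End}^0(T)=\mathrm{End}(T)\otimes\mathbb Q=\mathrm{End}_{\mathbb Q}(\Lambda_{\mathbb Q})\cap\mathrm{End}_{\mathbb C}(V)$ is a number field $E$ of degree $2g$ that is doubly transitive, i.e., $\mathrm{Aut}(\mathbb C)$ acts (by composition) doubly transitively on the $2g$-element set of field embeddings $E\hookrightarrow\mathbb C$. Let $\mathrm{Hdg}(T)$ be the Hodge group of $T$, i.e., the smallest algebraic $\mathbb Q$-subgroup $G$ of $\mathrm{GL}(\Lambda_{\mathbb Q})$ such that $G(\mathbb R)\subset\mathrm{Aut}_{\mathbb R}(\Lambda\otimes\mathbb R)=\mathrm{Aut}_{\mathbb R}(V)$ contains multiplication by $z$ for every complex number $z$ with $|z|=1$. Let $\mathcal S_E^1$ be the norm-one torus, i.e., the kernel of the norm character $\mathrm{Res}_{E/\mathbb Q}\mathbb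 G_m\to\mathbb G_m$, viewed as an algebraic $\mathbb Q$-subgroup of $\mathrm{GL}(\Lambda_{\mathbb Q})$ through the action of $E$ on $\Lambda_{\mathbb Q}$. Then: (i) $\mathrm{Hdg}(T)=\mathcal S_E^1$. In addition, $\mathrm{Hdg}(T)$ is a simple algebraic $\mathbb Q$-torus (it is nontrivial and has no algebraic $\mathbb Q$-subtori except the trivial one and itself) of dimension $2g-1$. (ii) The $\mathrm{Hdg}(T)$-module $\mathrm H^2(T,\mathbb Q)=\mathrm{Hom}_{\mathbb Q}(\wedge^2_{\mathbb Q}\Lambda_{\mathbb Q},\mathbb Q)$ is simple. In particular, $T$ is $2$-simple: if $H$ is a rational Hodge substructure of $\mathrm H^2(T,\mathbb Q)$ and $H_{\mathbb C}=H\otimes_{\mathbb Q}\mathbb C$ satisfies $H_{\mathbb C}\cap \mathrm H^{2,0}(T)\neq\{0\}$, then $H_{\mathbb C}\supset \mathrm H^{2,0}(T)$. -/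

import Mathlib

open scoped TensorProduct

noncomputable section

/-! ## Algebraic `ℚ`-subgroups of `GL(W)`

For a finite-dimensional rational vector space `W`, an algebraic `ℚ`-subgroup `G` of `GL(W)` is
described, in the classical language of algebraic groups, by its group `G(ℂ)` of complex points:
a subgroup of `GL(W_ℂ)` that is the set of common zeros of regular functions defined over `ℚ`.
In characteristic zero this is the same as a closed subgroup scheme of `GL(W)` over `ℚ`. -/

namespace AlgGroup

section Rational

variable (W : Type*) [AddCommGroup W] [Module ℚ W]

/-- The group `GL(W)(ℂ) = GL(W_ℂ)`. -/
abbrev GLC : Type _ := LinearMap.GeneralLinearGroup ℂ (ℂ ⊗[ℚ] W)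

variable {W} in
/-- The matrix coefficient `g ↦ φ(g w)` on `GL(W_ℂ)`, where `w ∈ W` and `φ` is a `ℚ`-linear
functional on `W`. -/
def matrixCoeff (φ : Module.Dual ℚ W) (w : W) (g : GLC W) : ℂ :=
  LinearMap.liftBaseChange ℂ ((Algebra.linearMap ℚ ℂ) ∘ₗ φ) (g.1 (1 ⊗ₜ[ℚ] w))

/-- The coordinate ring `ℚ[GL(W)]`, as a ring of functions on `GL(W_ℂ)`: it is generated over `ℚ`
by the rational matrix coefficients of `g` and of `g⁻¹`. -/
def regularQ : Subalgebra ℚ (GLC W → ℂ) :=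
  Algebra.adjoin ℚ
    ({f | ∃ φ w, f = fun g => matrixCoeff φ w g} ∪ {f | ∃ φ w, f = fun g => matrixCoeff φ w g⁻¹})

variable {W}

/-- The subgroup `G ⊆ GL(W_ℂ)` is (the group of complex points of) an algebraic `ℚ`-subgroup. -/
def IsAlgebraicOverQ (G : Subgroup (GLC W)) : Prop :=
  ∃ S : Set (GLC W → ℂ), S ⊆ regularQ W ∧ ∀ g, g ∈ G ↔ ∀ f ∈ S, f g = 0

theorem isAlgebraicOverQ_sInf (C : Set (Subgroup (GLC W))) (hC : ∀ G ∈ C, IsAlgebraicOverQ G) :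
    IsAlgebraicOverQ (sInf C) := by
  choose! S hS hG using hC
  refine ⟨⋃ G ∈ C, S G, ?_, fun g => ?_⟩
  · exact Set.iUnion₂_subset hS
  · rw [Subgroup.mem_sInf]
    constructor
    · intro hg f hf
      obtain ⟨G, hGC, hf⟩ := Set.mem_iUnion₂.1 hf
      exact (hG G hGC g).1 (hg G hGC) f hf
    · intro hg G hGC
      exact (hG G hGC g).2 fun f hf => hg f (Set.mem_iUnion₂.2 ⟨G, hGC, hf⟩)

end Rational

section Tori

/-- The coordinate ring of `GL(M)` for a complex vector space `M`, as a ring of functions. -/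
def regularC (M : Type*) [AddCommGroup M] [Module ℂ M] :
    Subalgebra ℂ (LinearMap.GeneralLinearGroup ℂ M → ℂ) :=
  Algebra.adjoin ℂ
    ({f | ∃ (φ : Module.Dual ℂ M) (m : M), f = fun g => φ (g.1 m)} ∪
      {f | ∃ (φ : Module.Dual ℂ M) (m : M), f = fun g => φ ((g⁻¹).1 m)})

/-- The coordinate ring of `𝔾ₘᵈ` over `ℂ` (the Laurent polynomials), as a ring of functions
on `(ℂˣ)ᵈ`. -/
def laurent (d : ℕ) : Subalgebra ℂ ((Fin d → ℂˣ) → ℂ) :=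
  Algebra.adjoin ℂ
    ({f | ∃ i, f = fun z => ((z i : ℂˣ) : ℂ)} ∪ {f | ∃ i, f = fun z => (((z i)⁻¹ : ℂˣ) : ℂ)})

/-- The (closed) subgroup `G` of `GL(M)` is isomorphic, as an algebraic group over `ℂ`, to
`𝔾ₘᵈ`: there is an isomorphism of groups that is regular in both directions. -/
def IsTorusOfDim {M : Type*} [AddCommGroup M] [Module ℂ M]
    (G : Subgroup (LinearMap.GeneralLinearGroup ℂ M)) (d : ℕ) : Prop :=
  ∃ φ : (Fin d → ℂˣ) ≃* G,
    (∀ f ∈ regularC M, (fun z => f (φ z)) ∈ laurent d) ∧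
    (∀ f ∈ laurent d, ∃ F ∈ regularC M, ∀ x : G, f (φ.symm x) = F x)

variable {W : Type*} [AddCommGroup W] [Module ℚ W]

/-- `G` is an algebraic `ℚ`-torus of dimension `d`: an algebraic `ℚ`-group that becomes
isomorphic to `𝔾ₘᵈ` over `ℂ`. -/
def IsQTorusOfDim (G : Subgroup (GLC W)) (d : ℕ) : Prop :=
  IsAlgebraicOverQ G ∧ IsTorusOfDim G d

/-- `G` is a simple algebraic `ℚ`-torus: a nontrivial algebraic `ℚ`-torus whose only algebraic
`ℚ`-subtori are the trivial one and `G`. -/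
def IsSimpleQTorus (G : Subgroup (GLC W)) : Prop :=
  (∃ d, IsQTorusOfDim G d) ∧ G ≠ ⊥ ∧
    ∀ S : Subgroup (GLC W), S ≤ G → (∃ d, IsQTorusOfDim S d) → S = ⊥ ∨ S = G

end Tori

section NormOne

variable (E : Type*) [Field E] [NumberField E]

/-- The complex points `(E ⊗_ℚ ℂ)ˣ` of `Res_{E/ℚ} 𝔾ₘ` of norm one, i.e. the complex points of
the norm-one torus `S_E^1`, the kernel of the norm character of `Res_{E/ℚ} 𝔾ₘ`. -/
def normOne : Subgroup (ℂ ⊗[ℚ] E)ˣ :=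
  (Units.map (Algebra.norm ℂ : (ℂ ⊗[ℚ] E) →* ℂ)).ker

variable {E} {W : Type*} [AddCommGroup W] [Module ℚ W]

/-- The `ℂ`-linear extension `E ⊗_ℚ ℂ → End_ℂ(W_ℂ)` of an action of `E` on `W`. -/
def actionC (ρ : E →ₐ[ℚ] Module.End ℚ W) : ℂ ⊗[ℚ] E →ₐ[ℂ] Module.End ℂ (ℂ ⊗[ℚ] W) :=
  Algebra.TensorProduct.lift (Algebra.ofId ℂ _) ((Module.End.baseChangeHom ℚ ℂ W).comp ρ)
    fun z _ => Algebra.commutes z _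

/-- `S_E^1` as a subgroup of `GL(W)`, for an action of `E` on `W`. -/
def normOneTorus (ρ : E →ₐ[ℚ] Module.End ℚ W) : Subgroup (GLC W) :=
  (normOne E).map (Units.map (actionC ρ : ℂ ⊗[ℚ] E →* Module.End ℂ (ℂ ⊗[ℚ] W)))

end NormOne

end AlgGroup

/-- `E` is a doubly transitive number field: the group `Aut(ℂ)` acts doubly transitively, by
composition, on the set of field embeddings of `E` in `ℂ`. -/
def IsDoublyTransitiveField (E : Type*) [Field E] [NumberField E] : Prop :=
  ∀ σ₁ σ₂ τ₁ τ₂ : E →+* ℂ, σ₁ ≠ σ₂ → τ₁ ≠ τ₂ →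
    ∃ t : ℂ ≃+* ℂ, (t : ℂ →+* ℂ).comp σ₁ = τ₁ ∧ (t : ℂ →+* ℂ).comp σ₂ = τ₂

/-! ## Complex tori

A complex torus `T = V/Λ` is given by a finite-dimensional complex vector space `V`
and a lattice `Λ` of full rank in `V`. -/

namespace ComplexTorus

section Lattice

variable {V : Type*} [NormedAddCommGroup V] [NormedSpace ℂ V] (Λ : Submodule ℤ V)

/-- `T = V/Λ` is simple: `T ≠ 0`, and the only complex subtori of `T` are `0` and `T`.
Complex subtori are the `W/(W ∩ Λ)` where `W` is a complex subspace of `V` in which `W ∩ Λ` is a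
lattice of full rank, i.e. spans `W` over `ℝ`. -/
def IsSimple : Prop :=
  Nontrivial V ∧ ∀ W : Submodule ℂ V,
    Submodule.span ℝ ((W : Set V) ∩ (Λ : Set V)) = W.restrictScalars ℝ → W = ⊥ ∨ W = ⊤

/-- `Λ_ℚ = H₁(T, ℚ)`. -/
abbrev H1Q : Type _ := ℚ ⊗[ℤ] Λ

/-- `Λ_ℂ = H₁(T, ℂ)`. -/
abbrev H1C : Type _ := ℂ ⊗[ℚ] H1Q Λ

/-- The canonical map `Λ ⊗ ℝ → V`, `l ⊗ r ↦ r l`. -/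
def latticeRealMap : ℝ ⊗[ℤ] Λ →ₗ[ℝ] V :=
  LinearMap.liftBaseChange ℝ Λ.subtype

/-- `H²(T, ℚ) = Hom_ℚ(⋀² Λ_ℚ, ℚ)`, the space of alternating bilinear forms on `Λ_ℚ`. -/
def H2Q : Submodule ℚ (LinearMap.BilinForm ℚ (H1Q Λ)) where
  carrier := {B | LinearMap.BilinForm.IsAlt B}
  zero_mem' := LinearMap.BilinForm.isAlt_zero
  add_mem' := fun h₁ h₂ => h₁.add h₂
  smul_mem' := fun c _ hB => LinearMap.BilinForm.IsAlt.smul c hB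

/-- `H²(T, ℂ) = Hom_ℂ(⋀² Λ_ℂ, ℂ)`, the space of alternating bilinear forms on `Λ_ℂ`. -/
def H2C : Submodule ℂ (LinearMap.BilinForm ℂ (H1C Λ)) where
  carrier := {B | LinearMap.BilinForm.IsAlt B}
  zero_mem' := LinearMap.BilinForm.isAlt_zero
  add_mem' := fun h₁ h₂ => h₁.add h₂
  smul_mem' := fun c _ hB => LinearMap.BilinForm.IsAlt.smul c hB

variable {Λ} in
/-- The complexification `H_ℂ = H ⊗_ℚ ℂ ⊆ H²(T, ℂ)` of a rational subspace `H ⊆ H²(T, ℚ)`. -/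
def complexSpan (H : Submodule ℚ (LinearMap.BilinForm ℚ (H1Q Λ))) :
    Submodule ℂ (LinearMap.BilinForm ℂ (H1C Λ)) :=
  Submodule.span ℂ ((fun B => LinearMap.BilinForm.baseChange ℂ B) '' H)

variable {Λ} in
/-- The natural action of `GL(Λ_ℂ)` on bilinear forms: `(g φ)(x, y) = φ(g⁻¹ x, g⁻¹ y)`. -/
def actForm (g : AlgGroup.GLC (H1Q Λ)) (φ : LinearMap.BilinForm ℂ (H1C Λ)) :
    LinearMap.BilinForm ℂ (H1C Λ) :=
  LinearMap.BilinForm.comp φ (g⁻¹).1 (g⁻¹).1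

variable {Λ} in
/-- The `G`-module `H²(T, ℚ)`, for an algebraic `ℚ`-subgroup `G` of `GL(Λ_ℚ)`, is simple: it is
nonzero, and its only rational subspaces `H` that are `G`-invariant (i.e. `H_ℂ` is invariant
under `G(ℂ)`) are `0` and `H²(T, ℚ)`. -/
def IsSimpleOnH2 (G : Subgroup (AlgGroup.GLC (H1Q Λ))) : Prop :=
  H2Q Λ ≠ ⊥ ∧ ∀ H ≤ H2Q Λ,
    (∀ g ∈ G, ∀ φ ∈ complexSpan H, actForm g φ ∈ complexSpan H) → H = ⊥ ∨ H = H2Q Λ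

end Lattice

variable {V : Type*} [NormedAddCommGroup V] [NormedSpace ℂ V] [FiniteDimensional ℂ V]
variable (Λ : Submodule ℤ V) [DiscreteTopology Λ] [IsZLattice ℝ Λ]

theorem latticeRealMap_bijective : Function.Bijective (latticeRealMap Λ) := by
  classical
  let b := Module.Free.chooseBasis ℤ Λ
  let e : ℝ ⊗[ℤ] Λ ≃ₗ[ℝ] V :=
    (Algebra.TensorProduct.basis ℝ b).equiv (b.ofZLatticeBasis ℝ Λ) (Equiv.refl _)
  have h : latticeRealMap Λ = e.toLinearMap := by
    refine (Algebra.TensorProduct.basis ℝ b).ext fun i => ?_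
    rw [LinearEquiv.coe_coe, Module.Basis.equiv_apply]
    simp [latticeRealMap]
  rw [h]
  exact e.bijective

/-- The canonical isomorphism `Λ_ℚ ⊗ ℝ ≃ V`. -/
def realEquiv : ℝ ⊗[ℚ] H1Q Λ ≃ₗ[ℝ] V :=
  (TensorProduct.AlgebraTensorModule.cancelBaseChange ℤ ℚ ℝ ℝ Λ).trans
    (LinearEquiv.ofBijective (latticeRealMap Λ) (latticeRealMap_bijective Λ))

/-- The inclusion `Λ_ℚ ⊆ V`. -/
def incl (x : H1Q Λ) : V := realEquiv Λ (1 ⊗ₜ[ℚ] x)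

/-- The endomorphism algebra `End⁰(T) = End_ℚ(Λ_ℚ) ∩ End_ℂ(V)`: all `ℚ`-linear operators on `Λ_ℚ`
that extend to `ℂ`-linear operators on `V`. -/
def endAlgebra : Subalgebra ℚ (Module.End ℚ (H1Q Λ)) where
  carrier := {u | ∃ f : V →ₗ[ℂ] V, ∀ x, f (incl Λ x) = incl Λ (u x)}
  mul_mem' := by
    rintro u v ⟨f, hf⟩ ⟨k, hk⟩
    exact ⟨f ∘ₗ k, fun x => by simp [hf, hk]⟩
  add_mem' := by
    rintro u v ⟨f, hf⟩ ⟨k, hk⟩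
    exact ⟨f + k, fun x => by
      rw [LinearMap.add_apply, hf, hk]; simp [incl, TensorProduct.tmul_add]⟩
  algebraMap_mem' := by
    intro q
    refine ⟨((q : ℝ) : ℂ) • LinearMap.id, fun x => ?_⟩
    have h : (1 : ℝ) ⊗ₜ[ℚ] (q • x) = (q : ℝ) • ((1 : ℝ) ⊗ₜ[ℚ] x) := by
      rw [TensorProduct.tmul_smul, ← algebraMap_smul ℝ q]
      rfl
    simp only [incl, Module.algebraMap_end_apply, h, map_smul, LinearMap.smul_apply,
      LinearMap.id_apply]
    exact (RCLike.real_smul_eq_coe_smul (K := ℂ) _ _).symm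

/-- The canonical isomorphism `Λ_ℂ = Λ_ℚ ⊗ ℂ ≃ V ⊗_ℝ ℂ = V_ℂ`. -/
def complexEquiv : H1C Λ ≃ₗ[ℂ] ℂ ⊗[ℝ] V :=
  (TensorProduct.AlgebraTensorModule.cancelBaseChange ℚ ℝ ℂ ℂ (H1Q Λ)).symm.trans
    ((realEquiv Λ).baseChange ℝ ℂ _ _)

/-- The complexification `u ↦ u_ℂ` of `ℝ`-linear operators on `V`, as operators on
`Λ_ℂ = V_ℂ`. -/
def complexify : Module.End ℝ V →* Module.End ℂ (H1C Λ) where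
  toFun u := (complexEquiv Λ).symm.conj (u.baseChange ℂ)
  map_one' := by
    rw [LinearMap.baseChange_one]
    exact LinearEquiv.conj_id _
  map_mul' u v := by
    rw [LinearMap.baseChange_mul]
    exact (LinearEquiv.conj_comp _ _ _)

/-- The operator on `Λ_ℂ = V_ℂ` induced by multiplication by a complex number on `V`. -/
def mulOperator : ℂ →* Module.End ℂ (H1C Λ) :=
  (complexify Λ).comp (Algebra.lsmul ℝ ℝ V : ℂ →ₐ[ℝ] Module.End ℝ V)

/-- The homomorphism `h : ℂˣ → Aut_ℝ(Λ_ℝ) ⊆ GL(Λ_ℂ)`; `h(z)` is multiplication by `z` in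
`Λ_ℝ = V`. -/
def hodgeHom : ℂˣ →* AlgGroup.GLC (H1Q Λ) :=
  Units.map (mulOperator Λ)

/-- The Hodge group `Hdg(T)`: the smallest algebraic `ℚ`-subgroup of `GL(Λ_ℚ)` whose group of real
points contains `h(z)` for all complex numbers `z` with `|z| = 1`. -/
def hodgeGroup : Subgroup (AlgGroup.GLC (H1Q Λ)) :=
  sInf {G | AlgGroup.IsAlgebraicOverQ G ∧ ∀ z : ℂˣ, ‖(z : ℂ)‖ = 1 → hodgeHom Λ z ∈ G}

theorem hodgeGroup_isLeast :
    IsLeast {G | AlgGroup.IsAlgebraicOverQ G ∧ ∀ z : ℂˣ, ‖(z : ℂ)‖ = 1 → hodgeHom Λ z ∈ G}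
      (hodgeGroup Λ) :=
  ⟨⟨AlgGroup.isAlgebraicOverQ_sInf _ fun _ hG => hG.1,
    fun z hz => Subgroup.mem_sInf.2 fun _ hG => hG.2 z hz⟩, fun _ hG => sInf_le hG⟩

/-! ### The Hodge structure on the second cohomology -/

/-- The operator `J_ℂ` on `Λ_ℂ = V_ℂ`, where `J` is multiplication by `i` on `V`. -/
def J : Module.End ℂ (H1C Λ) := mulOperator Λ Complex.I

/-- `H_{-1,0}(T)`, the `i`-eigenspace of `J_ℂ`. -/
def Hm10 : Submodule ℂ (H1C Λ) := Module.End.eigenspace (J Λ) Complex.I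

/-- `H_{0,-1}(T)`, the `(-i)`-eigenspace of `J_ℂ`. -/
def H0m1 : Submodule ℂ (H1C Λ) := Module.End.eigenspace (J Λ) (-Complex.I)

/-- The space of alternating forms on `Λ_ℂ` that vanish on `A × B`. -/
def formsVanishingOn (A B : Submodule ℂ (H1C Λ)) :
    Submodule ℂ (LinearMap.BilinForm ℂ (H1C Λ)) where
  carrier := {φ | φ ∈ H2C Λ ∧ ∀ x ∈ A, ∀ y ∈ B, φ x y = 0}
  zero_mem' := ⟨zero_mem _, fun _ _ _ _ => rfl⟩
  add_mem' := fun h₁ h₂ => ⟨add_mem h₁.1 h₂.1, fun x hx y hy => by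
    simp [h₁.2 x hx y hy, h₂.2 x hx y hy]⟩
  smul_mem' := fun c _ h => ⟨Submodule.smul_mem _ c h.1, fun x hx y hy => by
    simp [h.2 x hx y hy]⟩

/-- `H^{2,0}(T) = Hom_ℂ(⋀² H_{-1,0}, ℂ)`: the alternating forms that vanish as soon as one of
the arguments is in `H_{0,-1}`. -/
def H20 : Submodule ℂ (LinearMap.BilinForm ℂ (H1C Λ)) := formsVanishingOn Λ (H0m1 Λ) ⊤

/-- `H^{0,2}(T) = Hom_ℂ(⋀² H_{0,-1}, ℂ)`: the alternating forms that vanish as soon as one of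
the arguments is in `H_{-1,0}`. -/
def H02 : Submodule ℂ (LinearMap.BilinForm ℂ (H1C Λ)) := formsVanishingOn Λ (Hm10 Λ) ⊤

/-- `H^{1,1}(T) = Hom_ℂ(H_{-1,0}, ℂ) ∧ Hom_ℂ(H_{0,-1}, ℂ)`: the alternating forms that vanish
on `H_{-1,0} × H_{-1,0}` and on `H_{0,-1} × H_{0,-1}`. -/
def H11 : Submodule ℂ (LinearMap.BilinForm ℂ (H1C Λ)) :=
  formsVanishingOn Λ (Hm10 Λ) (Hm10 Λ) ⊓ formsVanishingOn Λ (H0m1 Λ) (H0m1 Λ)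

/-- The rational subspace `H` of `H²(T, ℚ)` is a rational Hodge substructure:
`H_ℂ` is the sum of its intersections with the `H^{p,q}(T)`. -/
def IsHodgeSubstructure (H : Submodule ℚ (LinearMap.BilinForm ℚ (H1Q Λ))) : Prop :=
  H ≤ H2Q Λ ∧
    complexSpan H = (complexSpan H ⊓ H20 Λ) ⊔ (complexSpan H ⊓ H11 Λ) ⊔ (complexSpan H ⊓ H02 Λ)

/-- `T` is `2`-simple (irreducible in weight `2`): `dim T ≥ 2`, and if `H` is a rational Hodge
substructure of `H²(T, ℚ)` such that `H_ℂ ∩ H^{2,0}(T) ≠ 0` then `H_ℂ` contains `H^{2,0}(T)`. -/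
def IsTwoSimple : Prop :=
  2 ≤ Module.finrank ℂ V ∧
    ∀ H, IsHodgeSubstructure Λ H → complexSpan H ⊓ H20 Λ ≠ ⊥ → H20 Λ ≤ complexSpan H

end ComplexTorus

end

noncomputable section

/-! ## Lattices stable under a doubly transitive permutation group -/

section DoublyTransitive

variable {ι : Type*} [Fintype ι] [DecidableEq ι]

/-- A subgroup of `ℤ^ι` that is saturated, stable under a doubly transitive group of
permutations, and contains a nonzero vector of sum zero, contains all differences of
basis vectors. -/
theorem single_sub_single_mem_of_doublyTransitive (Γ : Subgroup (Equiv.Perm ι))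
    (hΓ : ∀ a b c d : ι, a ≠ b → c ≠ d → ∃ p ∈ Γ, p a = c ∧ p b = d)
    (C : AddSubgroup (ι → ℤ)) (hC : ∀ p ∈ Γ, ∀ m ∈ C, m ∘ p ∈ C)
    (hsat : ∀ (N : ℤ) (m : ι → ℤ), N ≠ 0 → N • m ∈ C → m ∈ C)
    (n : ι → ℤ) (hn : n ∈ C) (hn0 : n ≠ 0) (hsum : ∑ i, n i = 0) (a b : ι) :
    Pi.single a 1 - Pi.single b 1 ∈ C := by
  classical
  by_cases hab : a = b
  · subst hab; simp
  obtain ⟨s, hs⟩ := Function.ne_iff.1 hn0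
  let P : Finset (Equiv.Perm ι) := Finset.univ.filter fun p => p ∈ Γ ∧ p s = s
  have hP1 : 1 ∈ P := by simp [P, Γ.one_mem]
  let y : ι → ℤ := ∑ p ∈ P, n ∘ p
  have hy (i : ι) : y i = ∑ p ∈ P, n (p i) := by simp [y, Finset.sum_apply]
  have hyC : y ∈ C := C.sum_mem fun p hp => hC p (by simp [P] at hp; exact hp.1) n hn
  have hys : y s ≠ 0 := by
    have : y s = P.card * n s := by
      rw [hy, Finset.sum_congr rfl (g := fun _ => n s)]
      · simp
      · intro p hp
        simp [P] at hp
        rw [hp.2]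
    rw [this]
    refine mul_ne_zero ?_ hs
    exact_mod_cast (Finset.card_pos.2 ⟨1, hP1⟩).ne'
  have hyconst : ∀ i j, i ≠ s → j ≠ s → y i = y j := by
    intro i j hi hj
    obtain ⟨q, hq, hqs, hqi⟩ := hΓ s i s j hi.symm hj.symm
    rw [hy, hy, ← hqi]
    refine Finset.sum_bij (fun p _ => p * q⁻¹) ?_ ?_ ?_ ?_
    · intro p hp
      simp only [P, Finset.mem_filter, Finset.mem_univ, true_and] at hp ⊢
      refine ⟨Γ.mul_mem hp.1 (Γ.inv_mem hq), ?_⟩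
      rw [Equiv.Perm.mul_apply, Equiv.Perm.inv_eq_iff_eq.2 hqs.symm, hp.2]
    · intro p _ p' _ h
      exact mul_right_cancel h
    · intro p hp
      simp only [P, Finset.mem_filter, Finset.mem_univ, true_and] at hp ⊢
      exact ⟨p * q, ⟨Γ.mul_mem hp.1 hq, by rw [Equiv.Perm.mul_apply, hqs, hp.2]⟩, by simp⟩
    · intro p _
      simp
  have hysum : ∑ i, y i = 0 := by
    simp_rw [hy]
    rw [Finset.sum_comm]
    refine Finset.sum_eq_zero fun p _ => ?_
    rw [Equiv.sum_comp p n, hsum]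
  obtain ⟨t, hts⟩ : ∃ t, t ≠ s := by
    by_contra! h
    exact hab ((h a).trans (h b).symm)
  have hyst : y s ≠ y t := by
    intro h
    have : ∀ i, y i = y s := fun i => by
      by_cases hi : i = s
      · rw [hi]
      · rw [hyconst i t hi hts, h]
    simp only [this, Finset.sum_const, Finset.card_univ, nsmul_eq_mul] at hysum
    have hc : (Fintype.card ι : ℤ) ≠ 0 := by
      exact_mod_cast (Fintype.card_pos_iff.2 ⟨s⟩).ne'
    exact (mul_ne_zero hc hys) hysum
  have hform : ∀ c : ι, ∃ m ∈ C, ∀ i, m i = y t + if i = c then y s - y t else 0 := by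
    intro c
    obtain ⟨d, hd⟩ : ∃ d, d ≠ c := by
      by_contra! h
      exact hab ((h a).trans (h b).symm)
    obtain ⟨p, hp, hps, -⟩ := hΓ c d s t hd.symm hts.symm
    refine ⟨y ∘ p, hC p hp y hyC, fun i => ?_⟩
    split_ifs with hi
    · subst hi; simp [hps]
    · rw [Function.comp_apply, hyconst (p i) t (fun h => hi (p.injective (h.trans hps.symm))) hts,
        add_zero]
  obtain ⟨m, hm, hm'⟩ := hform a
  obtain ⟨k, hk, hk'⟩ := hform b
  refine hsat (y s - y t) _ (sub_ne_zero.2 hyst) ?_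
  convert C.sub_mem hm hk using 1
  funext i
  simp only [Pi.smul_apply, Pi.sub_apply, hm', hk', Pi.single_apply, smul_eq_mul]
  split_ifs <;> ring

end DoublyTransitive

/-! ## Laurent polynomial functions on `ℂˣ` -/

/-- The Laurent polynomials in one variable, as functions on `ℂˣ`. -/
def laurentOne : Subalgebra ℂ (ℂˣ → ℂ) :=
  Algebra.adjoin ℂ {fun z : ℂˣ => (z : ℂ), fun z : ℂˣ => ((z⁻¹ : ℂˣ) : ℂ)}

theorem coe_zpow_mem_laurentOne (n : ℤ) : (fun z : ℂˣ => ((z ^ n : ℂˣ) : ℂ)) ∈ laurentOne := by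
  have h1 : (fun z : ℂˣ => (z : ℂ)) ∈ laurentOne := Algebra.subset_adjoin (by simp)
  have h2 : (fun z : ℂˣ => ((z⁻¹ : ℂˣ) : ℂ)) ∈ laurentOne := Algebra.subset_adjoin (by simp)
  obtain ⟨k, rfl | rfl⟩ := n.eq_nat_or_neg
  · convert laurentOne.pow_mem h1 k using 1
    funext z; simp
  · convert laurentOne.pow_mem h2 k using 1
    funext z; simp

theorem exists_polynomial_of_mem_laurentOne {f : ℂˣ → ℂ} (hf : f ∈ laurentOne) :
    ∃ (p : Polynomial ℂ) (N : ℕ), ∀ z : ℂˣ, f z * (z : ℂ) ^ N = p.eval (z : ℂ) := by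
  induction hf using Algebra.adjoin_induction with
  | mem f hf =>
    rcases hf with rfl | rfl
    · exact ⟨Polynomial.X, 0, fun z => by simp⟩
    · exact ⟨1, 1, fun z => by simp⟩
  | algebraMap c => exact ⟨Polynomial.C c, 0, fun z => by simp⟩
  | add f g _ _ hf hg =>
    obtain ⟨p, N, hp⟩ := hf
    obtain ⟨q, M, hq⟩ := hg
    refine ⟨p * Polynomial.X ^ M + q * Polynomial.X ^ N, N + M, fun z => ?_⟩
    simp only [Pi.add_apply, Polynomial.eval_add, Polynomial.eval_mul, ← hp, ← hq,
      Polynomial.eval_pow, Polynomial.eval_X]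
    ring
  | mul f g _ _ hf hg =>
    obtain ⟨p, N, hp⟩ := hf
    obtain ⟨q, M, hq⟩ := hg
    refine ⟨p * q, N + M, fun z => ?_⟩
    simp only [Pi.mul_apply, Polynomial.eval_mul, ← hp, ← hq]
    ring

/-- The unit circle is Zariski dense in `ℂˣ`. -/
theorem eq_zero_of_mem_laurentOne {f : ℂˣ → ℂ} (hf : f ∈ laurentOne)
    (h : ∀ z : ℂˣ, ‖(z : ℂ)‖ = 1 → f z = 0) (z : ℂˣ) : f z = 0 := by
  obtain ⟨p, N, hp⟩ := exists_polynomial_of_mem_laurentOne hf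
  have hp0 : p = 0 := by
    have hinf : (Metric.sphere (0 : ℂ) 1).Infinite :=
      (isPreconnected_sphere (by rw [Complex.rank_real_complex]; norm_num) 0 1).infinite_of_nontrivial
        ⟨1, by simp, -1, by simp, by norm_num⟩
    refine Polynomial.eq_zero_of_infinite_isRoot p (hinf.mono fun w hw => ?_)
    rw [mem_sphere_zero_iff_norm] at hw
    have h' := hp (Units.mk0 w (norm_ne_zero_iff.1 (by rw [hw]; exact one_ne_zero)))
    rw [h _ hw] at h'
    simpa [Polynomial.IsRoot] using h'.symm
  have := hp z
  rw [hp0, Polynomial.eval_zero] at this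
  exact (mul_eq_zero.1 this).resolve_right (pow_ne_zero _ z.ne_zero)

/-- A Laurent polynomial without zeros in `ℂˣ` is a monomial. -/
theorem exists_eq_zpow_of_mem_laurentOne {f : ℂˣ → ℂ} (hf : f ∈ laurentOne)
    (h0 : ∀ z, f z ≠ 0) (h1 : f 1 = 1) : ∃ n : ℤ, ∀ z : ℂˣ, f z = ((z ^ n : ℂˣ) : ℂ) := by
  obtain ⟨p, N, hp⟩ := exists_polynomial_of_mem_laurentOne hf
  have hroots : p.roots = Multiset.replicate (Multiset.card p.roots) 0 := by
    refine Multiset.eq_replicate_card.2 fun r hr => ?_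
    by_contra hr0
    have hr' := hp (Units.mk0 r hr0)
    rw [Units.val_mk0, (Polynomial.isRoot_of_mem_roots hr).eq_zero] at hr'
    exact mul_ne_zero (h0 _) (pow_ne_zero _ hr0) hr'
  have hsplit := (IsAlgClosed.splits p).eq_prod_roots
  set m := Multiset.card p.roots with hm
  rw [hroots] at hsplit
  have hpe (z : ℂ) : p.eval z = p.leadingCoeff * z ^ m := by
    conv_lhs => rw [hsplit]
    simp
  have hlead : p.leadingCoeff = 1 := by
    have := hp 1
    simpa [h1, hpe] using this.symm
  refine ⟨m - N, fun z => ?_⟩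
  have := hp z
  rw [hpe, hlead, one_mul] at this
  have hz : (z : ℂ) ≠ 0 := z.ne_zero
  rw [Units.val_zpow_eq_zpow_val, zpow_sub₀ hz, eq_div_iff (zpow_ne_zero _ hz), zpow_natCast,
    zpow_natCast, this]

/-! ## The coordinates of `E ⊗_ℚ ℂ` given by the embeddings of `E` -/

namespace AlgGroup

section Coordinates

variable (E : Type*) [Field E] [NumberField E]

/-- The canonical map `E ⊗_ℚ ℂ → ℂ^{Hom(E, ℂ)}`. -/
def embeddingHom : ℂ ⊗[ℚ] E →ₐ[ℂ] ((E →+* ℂ) → ℂ) :=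
  Algebra.TensorProduct.lift (Algebra.ofId ℂ _) (NumberField.canonicalEmbedding E).toRatAlgHom
    fun _ _ => Commute.all _ _

variable {E} in
@[simp]
theorem embeddingHom_tmul (z : ℂ) (a : E) (σ : E →+* ℂ) :
    embeddingHom E (z ⊗ₜ a) σ = z * σ a := by
  simp [embeddingHom, Algebra.ofId_apply]

theorem embeddingHom_bijective : Function.Bijective (embeddingHom E) := by
  let b := Algebra.TensorProduct.basis ℂ (NumberField.integralBasis E)
  let e : ℂ ⊗[ℚ] E ≃ₗ[ℂ] ((E →+* ℂ) → ℂ) :=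
    b.equiv (NumberField.canonicalEmbedding.latticeBasis E) (Equiv.refl _)
  have h : (embeddingHom E).toLinearMap = e.toLinearMap := by
    refine b.ext fun i => ?_
    rw [LinearEquiv.coe_coe, Module.Basis.equiv_apply]
    funext σ
    simp [b, NumberField.canonicalEmbedding.latticeBasis_apply]
  have h' : ⇑(embeddingHom E) = e := funext fun x => LinearMap.congr_fun h x
  rw [h']
  exact e.bijective

/-- The canonical isomorphism `E ⊗_ℚ ℂ ≃ ℂ^{Hom(E, ℂ)}`. -/
def embeddingEquiv : (ℂ ⊗[ℚ] E) ≃ₐ[ℂ] ((E →+* ℂ) → ℂ) :=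
  AlgEquiv.ofBijective (embeddingHom E) (embeddingHom_bijective E)

variable {E} in
@[simp]
theorem embeddingEquiv_tmul (z : ℂ) (a : E) (σ : E →+* ℂ) :
    embeddingEquiv E (z ⊗ₜ a) σ = z * σ a :=
  embeddingHom_tmul z a σ

variable {E} {W : Type*} [AddCommGroup W] [Module ℚ W]

/-- The coordinates on `W_ℂ` given by the embeddings of `E` and an isomorphism `W ≃ E`. -/
def coord (κ : W ≃ₗ[ℚ] E) : ℂ ⊗[ℚ] W ≃ₗ[ℂ] ((E →+* ℂ) → ℂ) :=
  (κ.baseChange ℚ ℂ W E).trans (embeddingEquiv E).toLinearEquiv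

@[simp]
theorem coord_tmul (κ : W ≃ₗ[ℚ] E) (z : ℂ) (w : W) (σ : E →+* ℂ) :
    coord κ (z ⊗ₜ w) σ = z * σ (κ w) := by
  simp [coord]

/-- The operator on `W_ℂ` that is diagonal in the coordinates given by the embeddings of `E`. -/
def diagEnd (κ : W ≃ₗ[ℚ] E) : ((E →+* ℂ) → ℂ) →* Module.End ℂ (ℂ ⊗[ℚ] W) where
  toFun μ := (coord κ).symm.conj (LinearMap.mulLeft ℂ μ)
  map_one' := by
    rw [LinearMap.mulLeft_one]
    exact LinearEquiv.conj_id _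
  map_mul' μ ν := by
    rw [LinearMap.mulLeft_mul]
    exact LinearEquiv.conj_comp _ _ _

@[simp]
theorem coord_diagEnd (κ : W ≃ₗ[ℚ] E) (μ : (E →+* ℂ) → ℂ) (x : ℂ ⊗[ℚ] W) :
    coord κ (diagEnd κ μ x) = μ * coord κ x := by
  simp [diagEnd, LinearEquiv.conj_apply]

theorem mulLeft_eq_toLin' {ι : Type*} [Fintype ι] [DecidableEq ι] (μ : ι → ℂ) :
    LinearMap.mulLeft ℂ μ = Matrix.toLin' (Matrix.diagonal μ) := by
  refine LinearMap.ext fun x => ?_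
  funext i
  simp [Matrix.mulVec_diagonal]

theorem det_diagEnd (κ : W ≃ₗ[ℚ] E) (μ : (E →+* ℂ) → ℂ) :
    LinearMap.det (diagEnd κ μ) = ∏ σ, μ σ := by
  classical
  change LinearMap.det ((coord κ).symm.conj (LinearMap.mulLeft ℂ μ)) = _
  rw [LinearEquiv.conj_apply, LinearMap.comp_assoc, mulLeft_eq_toLin']
  have := LinearMap.det_conj (Matrix.toLin' (Matrix.diagonal μ)) (coord κ).symm
  rw [LinearMap.det_toLin', Matrix.det_diagonal] at this
  rw [← this]

theorem trace_diagEnd (κ : W ≃ₗ[ℚ] E) (μ : (E →+* ℂ) → ℂ) :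
    LinearMap.trace ℂ _ (diagEnd κ μ) = ∑ σ, μ σ := by
  classical
  change LinearMap.trace ℂ _ ((coord κ).symm.conj (LinearMap.mulLeft ℂ μ)) = _
  rw [LinearMap.trace_conj', mulLeft_eq_toLin', Matrix.trace_toLin'_eq, Matrix.trace_diagonal]

/-- An operator on `W_ℂ` that commutes with `E` is diagonal. -/
theorem exists_eq_diagEnd (κ : W ≃ₗ[ℚ] E) (ρ : E →ₐ[ℚ] Module.End ℚ W)
    (hκ : ∀ a w, κ (ρ a w) = a * κ w) (u : Module.End ℂ (ℂ ⊗[ℚ] W))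
    (hu : ∀ a x, u ((ρ a).baseChange ℂ x) = (ρ a).baseChange ℂ (u x)) :
    ∃ μ, u = diagEnd κ μ := by
  have hact (a : E) (x : ℂ ⊗[ℚ] W) (σ : E →+* ℂ) :
      coord κ ((ρ a).baseChange ℂ x) σ = σ a * coord κ x σ := by
    induction x with
    | zero => simp
    | tmul z w => simp [hκ]; ring
    | add x y hx hy => simp [hx, hy, mul_add]
  refine ⟨coord κ (u (1 ⊗ₜ κ.symm 1)), LinearMap.ext fun x => (coord κ).injective ?_⟩
  rw [coord_diagEnd]
  induction x with
  | zero => simp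
  | tmul z w =>
    have : z ⊗ₜ[ℚ] w = z • (ρ (κ w)).baseChange ℂ (1 ⊗ₜ κ.symm 1) := by
      rw [LinearMap.baseChange_tmul, TensorProduct.smul_tmul', smul_eq_mul, mul_one]
      congr 1
      exact κ.injective (by simp [hκ])
    rw [this, map_smul, hu]
    funext σ
    simp [hact, hκ]
    ring
  | add x y hx hy => simp [hx, hy, mul_add]

/-- The diagonal torus of `GL(W_ℂ)`. -/
def diagGL (κ : W ≃ₗ[ℚ] E) : ((E →+* ℂ) → ℂˣ) →* GLC W :=
  (Units.map (diagEnd κ)).comp MulEquiv.piUnits.symm.toMonoidHom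

@[simp]
theorem coord_diagGL (κ : W ≃ₗ[ℚ] E) (l : (E →+* ℂ) → ℂˣ) (x : ℂ ⊗[ℚ] W) (σ : E →+* ℂ) :
    coord κ ((diagGL κ l).1 x) σ = l σ * coord κ x σ := by
  change coord κ (diagEnd κ (fun σ => (l σ : ℂ)) x) σ = _
  simp

theorem val_diagGL (κ : W ≃ₗ[ℚ] E) (l : (E →+* ℂ) → ℂˣ) :
    (diagGL κ l).1 = diagEnd κ fun σ => (l σ : ℂ) := rfl

theorem eq_diagGL_iff (κ : W ≃ₗ[ℚ] E) (u : GLC W) (l : (E →+* ℂ) → ℂˣ) :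
    u = diagGL κ l ↔ ∀ x σ, coord κ (u.1 x) σ = l σ * coord κ x σ := by
  refine ⟨fun h x σ => by rw [h, coord_diagGL], fun h => Units.ext (LinearMap.ext fun x => ?_)⟩
  refine (coord κ).injective (funext fun σ => ?_)
  rw [h, coord_diagGL]

theorem diagGL_injective (κ : W ≃ₗ[ℚ] E) : Function.Injective (diagGL κ) := by
  intro l l' h
  funext σ
  have h1 := coord_diagGL κ l ((coord κ).symm 1) σ
  rw [h, coord_diagGL] at h1
  exact Units.ext (by simpa using h1.symm)

theorem exists_eq_diagGL (κ : W ≃ₗ[ℚ] E) (u : GLC W) (μ : (E →+* ℂ) → ℂ)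
    (hu : u.1 = diagEnd κ μ) : ∃ l, u = diagGL κ l ∧ ∀ σ, (l σ : ℂ) = μ σ := by
  have hμ (σ : E →+* ℂ) : μ σ ≠ 0 := by
    intro h0
    have h := coord_diagEnd κ μ ((u⁻¹).1 ((coord κ).symm 1))
    rw [← hu, ← Module.End.mul_apply, ← Units.val_mul, mul_inv_cancel] at h
    have := congrFun h σ
    simp [h0] at this
  refine ⟨fun σ => Units.mk0 (μ σ) (hμ σ), (eq_diagGL_iff κ u _).2 fun x σ => ?_, fun σ => rfl⟩
  rw [hu, coord_diagEnd]
  simp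

theorem actionC_tmul_apply (ρ : E →ₐ[ℚ] Module.End ℚ W) (c : ℂ) (a : E) (x : ℂ ⊗[ℚ] W) :
    actionC ρ (c ⊗ₜ a) x = c • (ρ a).baseChange ℂ x := by
  have h := Algebra.TensorProduct.lift_tmul (Algebra.ofId ℂ (Module.End ℂ (ℂ ⊗[ℚ] W)))
    ((Module.End.baseChangeHom ℚ ℂ W).comp ρ) (fun z _ => Algebra.commutes z _) c a
  exact LinearMap.congr_fun h x

theorem coord_actionC (κ : W ≃ₗ[ℚ] E) (ρ : E →ₐ[ℚ] Module.End ℚ W)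
    (hκ : ∀ a w, κ (ρ a w) = a * κ w) (y : ℂ ⊗[ℚ] E) (x : ℂ ⊗[ℚ] W) :
    coord κ (actionC ρ y x) = embeddingEquiv E y * coord κ x := by
  induction y with
  | zero => simp
  | tmul c a =>
    induction x with
    | zero => simp
    | tmul z w =>
      funext σ
      simp [actionC_tmul_apply, hκ]
      ring
    | add x y hx hy => simp [hx, hy, mul_add]
  | add x y hx hy => simp [hx, hy, add_mul]

theorem norm_eq_prod_embeddings (y : ℂ ⊗[ℚ] E) :
    Algebra.norm ℂ y = ∏ σ, embeddingEquiv E y σ := by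
  rw [Algebra.norm_apply, ← det_diagEnd (LinearEquiv.refl ℚ E)]
  congr 1
  refine LinearMap.ext fun x => (coord (LinearEquiv.refl ℚ E)).injective ?_
  have h (x : ℂ ⊗[ℚ] E) : coord (LinearEquiv.refl ℚ E) x = embeddingEquiv E x := by
    induction x with
    | zero => simp
    | tmul z w => funext σ; simp
    | add x y hx hy => simp [hx, hy]
  rw [coord_diagEnd, h, h]
  simp

theorem mem_normOneTorus_iff (κ : W ≃ₗ[ℚ] E) (ρ : E →ₐ[ℚ] Module.End ℚ W)
    (hκ : ∀ a w, κ (ρ a w) = a * κ w) (u : GLC W) :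
    u ∈ normOneTorus ρ ↔ ∃ l, u = diagGL κ l ∧ ∏ σ, l σ = 1 := by
  constructor
  · rintro ⟨y, hy, rfl⟩
    obtain ⟨l, hl, hl'⟩ := exists_eq_diagGL κ
      (Units.map (actionC ρ : ℂ ⊗[ℚ] E →* Module.End ℂ (ℂ ⊗[ℚ] W)) y) (embeddingEquiv E y.1)
      (LinearMap.ext fun x => (coord κ).injective (by
        rw [coord_diagEnd]; exact coord_actionC κ ρ hκ _ _))
    refine ⟨l, hl, Units.ext ?_⟩
    have hy' : Algebra.norm ℂ y.1 = 1 := congrArg Units.val (MonoidHom.mem_ker.1 hy)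
    rw [norm_eq_prod_embeddings] at hy'
    simpa [hl'] using hy'
  · rintro ⟨l, rfl, hl⟩
    let y : (ℂ ⊗[ℚ] E)ˣ := Units.map (embeddingEquiv E).symm.toMulEquiv.toMonoidHom
      (MulEquiv.piUnits.symm l)
    have hy (σ : E →+* ℂ) : embeddingEquiv E y.1 σ = l σ :=
      congrFun ((embeddingEquiv E).apply_symm_apply _) σ
    refine ⟨y, MonoidHom.mem_ker.2 (Units.ext ?_), ?_⟩
    · change Algebra.norm ℂ y.1 = 1
      rw [norm_eq_prod_embeddings]
      simp only [hy]
      simpa using congrArg Units.val hl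
    · refine (eq_diagGL_iff κ _ l).2 fun x σ => ?_
      change coord κ (actionC ρ y.1 x) σ = _
      rw [coord_actionC κ ρ hκ, Pi.mul_apply, hy]

end Coordinates

/-! ## The action of `Aut(ℂ)` -/

section Galois

variable {W : Type*} [AddCommGroup W] [Module ℚ W]

/-- The semilinear action of `Aut(ℂ)` on `W_ℂ`. -/
def galois (t : ℂ ≃+* ℂ) : ℂ ⊗[ℚ] W ≃ₗ[ℚ] ℂ ⊗[ℚ] W :=
  TensorProduct.congr t.toRatAlgEquiv.toLinearEquiv (LinearEquiv.refl ℚ W)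

@[simp]
theorem galois_tmul (t : ℂ ≃+* ℂ) (z : ℂ) (w : W) : galois t (z ⊗ₜ[ℚ] w) = t z ⊗ₜ w := rfl

@[simp]
theorem galois_symm_tmul (t : ℂ ≃+* ℂ) (z : ℂ) (w : W) :
    (galois t).symm (z ⊗ₜ[ℚ] w) = t.symm z ⊗ₜ w := rfl

theorem galois_smul (t : ℂ ≃+* ℂ) (z : ℂ) (x : ℂ ⊗[ℚ] W) :
    galois t (z • x) = t z • galois t x := by
  induction x with
  | zero => simp
  | tmul c w => simp [TensorProduct.smul_tmul']
  | add x y hx hy => simp [hx, hy]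

theorem galois_symm_smul (t : ℂ ≃+* ℂ) (z : ℂ) (x : ℂ ⊗[ℚ] W) :
    (galois t).symm (z • x) = t.symm z • (galois t).symm x := by
  rw [LinearEquiv.symm_apply_eq, galois_smul]
  simp

/-- The action of `Aut(ℂ)` on the operators on `W_ℂ`. -/
def galoisEnd (t : ℂ ≃+* ℂ) : Module.End ℂ (ℂ ⊗[ℚ] W) →* Module.End ℂ (ℂ ⊗[ℚ] W) where
  toFun u :=
    { toFun := fun x => galois t (u ((galois t).symm x))
      map_add' := fun x y => by simp
      map_smul' := fun z x => by simp [galois_symm_smul, galois_smul] }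
  map_one' := LinearMap.ext fun x => by simp
  map_mul' u v := LinearMap.ext fun x => by simp

@[simp]
theorem galoisEnd_apply (t : ℂ ≃+* ℂ) (u : Module.End ℂ (ℂ ⊗[ℚ] W)) (x : ℂ ⊗[ℚ] W) :
    galoisEnd t u x = galois t (u ((galois t).symm x)) := rfl

/-- The action of `Aut(ℂ)` on `GL(W)(ℂ)`. -/
def galoisGL (t : ℂ ≃+* ℂ) : GLC W →* GLC W := Units.map (galoisEnd t)

theorem val_galoisGL (t : ℂ ≃+* ℂ) (u : GLC W) : (galoisGL t u).1 = galoisEnd t u.1 := rfl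

theorem matrixCoeff_galoisGL (t : ℂ ≃+* ℂ) (φ : Module.Dual ℚ W) (w : W) (u : GLC W) :
    matrixCoeff φ w (galoisGL t u) = t (matrixCoeff φ w u) := by
  have h (x : ℂ ⊗[ℚ] W) : LinearMap.liftBaseChange ℂ ((Algebra.linearMap ℚ ℂ) ∘ₗ φ) (galois t x) =
      t (LinearMap.liftBaseChange ℂ ((Algebra.linearMap ℚ ℂ) ∘ₗ φ) x) := by
    induction x with
    | zero => simp
    | tmul c w => simp
    | add x y hx hy => simp only [map_add, hx, hy]
  simp only [matrixCoeff, val_galoisGL, galoisEnd_apply, h, galois_symm_tmul, map_one]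

theorem regularQ_galoisGL (t : ℂ ≃+* ℂ) {f : GLC W → ℂ} (hf : f ∈ regularQ W) (u : GLC W) :
    f (galoisGL t u) = t (f u) := by
  induction hf using Algebra.adjoin_induction with
  | mem f hf =>
    rcases hf with ⟨φ, w, rfl⟩ | ⟨φ, w, rfl⟩
    · exact matrixCoeff_galoisGL t φ w u
    · simp only [← map_inv]
      exact matrixCoeff_galoisGL t φ w u⁻¹
  | algebraMap c => simp
  | add f g _ _ hf hg => simp [hf, hg]
  | mul f g _ _ hf hg => simp [hf, hg]

/-- The subgroup `G ⊆ GL(W_ℂ)` is stable under `Aut(ℂ)`. -/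
def IsGaloisStable (G : Subgroup (GLC W)) : Prop :=
  ∀ (t : ℂ ≃+* ℂ), ∀ u ∈ G, galoisGL t u ∈ G

theorem IsAlgebraicOverQ.isGaloisStable {G : Subgroup (GLC W)} (hG : IsAlgebraicOverQ G) :
    IsGaloisStable G := by
  obtain ⟨S, hS, h⟩ := hG
  intro t u hu
  refine (h _).2 fun f hf => ?_
  rw [regularQ_galoisGL t (hS hf), (h u).1 hu f hf, map_zero]

variable {E : Type*} [Field E] [NumberField E]

theorem coord_galois (κ : W ≃ₗ[ℚ] E) (t : ℂ ≃+* ℂ) (x : ℂ ⊗[ℚ] W) (σ : E →+* ℂ) :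
    coord κ (galois t x) ((t : ℂ →+* ℂ).comp σ) = t (coord κ x σ) := by
  induction x with
  | zero => simp
  | tmul c w => simp
  | add x y hx hy => simp [hx, hy]

/-- The action of `Aut(ℂ)` on the embeddings of `E`. -/
def embeddingPerm (E : Type*) [Field E] : (ℂ ≃+* ℂ) →* Equiv.Perm (E →+* ℂ) where
  toFun t :=
    { toFun := fun σ => (t : ℂ →+* ℂ).comp σ
      invFun := fun σ => (t.symm : ℂ →+* ℂ).comp σ
      left_inv := fun σ => by ext; simp
      right_inv := fun σ => by ext; simp }
  map_one' := by ext; rfl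
  map_mul' t s := by ext; rfl

theorem coord_galois' (κ : W ≃ₗ[ℚ] E) (t : ℂ ≃+* ℂ) (x : ℂ ⊗[ℚ] W) (σ : E →+* ℂ) :
    coord κ (galois t x) σ = t (coord κ x ((embeddingPerm E t).symm σ)) := by
  rw [← coord_galois]
  exact congrArg _ ((embeddingPerm E t).apply_symm_apply σ).symm

theorem galoisGL_diagGL (κ : W ≃ₗ[ℚ] E) (t : ℂ ≃+* ℂ) (l : (E →+* ℂ) → ℂˣ) :
    galoisGL t (diagGL κ l) =
      diagGL κ fun σ => Units.map (t : ℂ →* ℂ) (l ((embeddingPerm E t).symm σ)) := by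
  refine (eq_diagGL_iff κ _ _).2 fun x σ => ?_
  obtain ⟨y, rfl⟩ := (galois t).surjective x
  rw [val_galoisGL, galoisEnd_apply, LinearEquiv.symm_apply_apply, coord_galois', coord_galois',
    coord_diagGL]
  simp

end Galois

end AlgGroup

namespace AlgGroup

variable {E : Type*} [Field E] [NumberField E] {W : Type*} [AddCommGroup W] [Module ℚ W]

/-! ## Galois stable groups that contain a one-parameter subgroup of the diagonal torus -/

/-- The cocharacters of the diagonal torus with image in `G`. -/
def cocharacters (κ : W ≃ₗ[ℚ] E) (G : Subgroup (GLC W)) : AddSubgroup ((E →+* ℂ) → ℤ) where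
  carrier := {n | ∀ z : ℂˣ, diagGL κ (fun σ => z ^ n σ) ∈ G}
  zero_mem' z := by
    have : (fun σ : E →+* ℂ => z ^ (0 : (E →+* ℂ) → ℤ) σ) = 1 := by funext; simp
    rw [this, map_one]
    exact G.one_mem
  add_mem' {m n} hm hn z := by
    have : (fun σ : E →+* ℂ => z ^ (m + n) σ) = (fun σ => z ^ m σ) * fun σ => z ^ n σ := by
      funext; simp [zpow_add]
    rw [this, map_mul]
    exact G.mul_mem (hm z) (hn z)
  neg_mem' {m} hm z := by
    have : (fun σ : E →+* ℂ => z ^ (-m) σ) = (fun σ => z ^ m σ)⁻¹ := by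
      funext; simp
    rw [this, map_inv]
    exact G.inv_mem (hm z)

theorem zpow_sum {ι : Type*} (s : Finset ι) (n : ι → ℤ) (z : ℂˣ) :
    z ^ (∑ i ∈ s, n i) = ∏ i ∈ s, z ^ n i := by
  classical
  induction s using Finset.induction_on with
  | empty => simp
  | insert a s ha ih => rw [Finset.sum_insert ha, Finset.prod_insert ha, zpow_add, ih]

theorem exists_zpow_eq (N : ℤ) (hN : N ≠ 0) (z : ℂˣ) : ∃ w : ℂˣ, w ^ N = z := by
  have key (k : ℕ) (hk : k ≠ 0) (z : ℂˣ) : ∃ w : ℂˣ, w ^ k = z := by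
    obtain ⟨w, hw⟩ := IsAlgClosed.exists_pow_nat_eq (z : ℂ) (Nat.pos_of_ne_zero hk)
    have hw0 : w ≠ 0 := by
      rintro rfl
      rw [zero_pow hk] at hw
      exact z.ne_zero hw.symm
    exact ⟨Units.mk0 w hw0, Units.ext (by simpa using hw)⟩
  obtain ⟨k, rfl | rfl⟩ := N.eq_nat_or_neg
  · simpa using key k (by simpa using hN) z
  · obtain ⟨w, hw⟩ := key k (by simpa using hN) z⁻¹
    exact ⟨w, by rw [zpow_neg, zpow_natCast, hw, inv_inv]⟩

theorem single_sub_single_mem_cocharacters [DecidableEq (E →+* ℂ)]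
    (hE : IsDoublyTransitiveField E) (κ : W ≃ₗ[ℚ] E)
    (G : Subgroup (GLC W)) (hG : IsGaloisStable G) (n : (E →+* ℂ) → ℤ) (hn0 : n ≠ 0)
    (hsum : ∑ σ, n σ = 0) (hn : n ∈ cocharacters κ G) (a b : E →+* ℂ) :
    Pi.single a 1 - Pi.single b 1 ∈ cocharacters κ G := by
  refine single_sub_single_mem_of_doublyTransitive (embeddingPerm E).range ?_ _ ?_ ?_ n hn hn0
    hsum a b
  · intro a b c d hab hcd
    obtain ⟨t, h1, h2⟩ := hE a b c d hab hcd
    exact ⟨_, ⟨t, rfl⟩, h1, h2⟩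
  · rintro _ ⟨t, rfl⟩ m hm z
    obtain ⟨w, rfl⟩ : ∃ w : ℂˣ, Units.map (t⁻¹ : ℂ ≃+* ℂ) w = z :=
      ⟨Units.map (t : ℂ →* ℂ) z, Units.ext (t.symm_apply_apply _)⟩
    have := hG t⁻¹ _ (hm w)
    rw [galoisGL_diagGL] at this
    convert this using 2
    funext σ
    rw [map_zpow, map_inv]
    rfl
  · intro N m hN hm z
    obtain ⟨w, rfl⟩ := exists_zpow_eq N hN z
    simpa [zpow_mul] using hm w

/-- A Galois stable group that contains a nontrivial one-parameter group of diagonal operators of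
norm one contains all diagonal operators of norm one. -/
theorem diagGL_mem_of_mem_cocharacters (hE : IsDoublyTransitiveField E) (κ : W ≃ₗ[ℚ] E)
    (G : Subgroup (GLC W)) (hG : IsGaloisStable G) (n : (E →+* ℂ) → ℤ) (hn0 : n ≠ 0)
    (hsum : ∑ σ, n σ = 0) (hn : n ∈ cocharacters κ G) (l : (E →+* ℂ) → ℂˣ)
    (hl : ∏ σ, l σ = 1) : diagGL κ l ∈ G := by
  classical
  obtain ⟨s, -⟩ := Function.ne_iff.1 hn0
  have h (σ : E →+* ℂ) : (fun τ => l σ ^ (Pi.single σ 1 - Pi.single s 1 : (E →+* ℂ) → ℤ) τ) ∈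
      G.comap (diagGL κ) :=
    single_sub_single_mem_cocharacters hE κ G hG n hn0 hsum hn σ s (l σ)
  have hprod := (G.comap (diagGL κ)).prod_mem (t := Finset.univ) fun σ _ => h σ
  convert hprod using 1
  change _ ↔ diagGL κ (∏ σ, _) ∈ G
  suffices hl' : l = ∏ σ, fun τ => l σ ^ (Pi.single σ 1 - Pi.single s 1 : (E →+* ℂ) → ℤ) τ by
    rw [← hl']
  funext τ
  simp only [Finset.prod_apply, Pi.sub_apply, zpow_sub, Finset.prod_mul_distrib]
  rw [Finset.prod_eq_single τ (fun b _ hb => by simp [hb.symm]) (by simp)]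
  simp only [Pi.single_eq_same, zpow_one, Finset.prod_inv_distrib]
  by_cases hτ : τ = s
  · subst hτ; simp [hl]
  · simp [hτ]

theorem normOneTorus_le (hE : IsDoublyTransitiveField E) (κ : W ≃ₗ[ℚ] E)
    (ρ : E →ₐ[ℚ] Module.End ℚ W) (hκ : ∀ a w, κ (ρ a w) = a * κ w)
    (G : Subgroup (GLC W)) (hG : IsGaloisStable G) (n : (E →+* ℂ) → ℤ) (hn0 : n ≠ 0)
    (hsum : ∑ σ, n σ = 0) (hn : n ∈ cocharacters κ G) : normOneTorus ρ ≤ G := by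
  intro u hu
  obtain ⟨l, rfl, hl⟩ := (mem_normOneTorus_iff κ ρ hκ u).1 hu
  exact diagGL_mem_of_mem_cocharacters hE κ G hG n hn0 hsum hn l hl

/-! ## Regular functions on the diagonal torus -/

theorem regularC_of_regularQ {f : GLC W → ℂ} (hf : f ∈ regularQ W) :
    f ∈ regularC (ℂ ⊗[ℚ] W) := by
  induction hf using Algebra.adjoin_induction with
  | mem f hf =>
    refine Algebra.subset_adjoin ?_
    rcases hf with ⟨φ, w, rfl⟩ | ⟨φ, w, rfl⟩
    · exact Or.inl ⟨_, _, rfl⟩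
    · exact Or.inr ⟨_, _, rfl⟩
  | algebraMap c =>
    convert (regularC (ℂ ⊗[ℚ] W)).algebraMap_mem (c : ℂ) using 1
    funext u; simp
  | add f g _ _ hf hg => exact add_mem hf hg
  | mul f g _ _ hf hg => exact mul_mem hf hg

theorem dual_diagGL [DecidableEq (E →+* ℂ)] (κ : W ≃ₗ[ℚ] E) (φ : Module.Dual ℂ (ℂ ⊗[ℚ] W))
    (x : ℂ ⊗[ℚ] W) (l : (E →+* ℂ) → ℂˣ) :
    φ ((diagGL κ l).1 x) =
      ∑ σ, (l σ : ℂ) * (coord κ x σ * φ ((coord κ).symm (Pi.single σ 1))) := by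
  have h : (diagGL κ l).1 x =
      ∑ σ, ((l σ : ℂ) * coord κ x σ) • (coord κ).symm (Pi.single σ 1) := by
    refine (coord κ).injective (funext fun τ => ?_)
    rw [coord_diagGL, map_sum, Finset.sum_apply]
    simp [Pi.single_apply]
  rw [h, map_sum]
  simp [mul_assoc]

theorem regularC_comp_diagGL {X : Type*} (A : Subalgebra ℂ (X → ℂ)) (κ : W ≃ₗ[ℚ] E)
    (l : X → (E →+* ℂ) → ℂˣ) (h1 : ∀ σ, (fun x => (l x σ : ℂ)) ∈ A)
    (h2 : ∀ σ, (fun x => (((l x σ)⁻¹ : ℂˣ) : ℂ)) ∈ A) {f : GLC W → ℂ}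
    (hf : f ∈ regularC (ℂ ⊗[ℚ] W)) : (fun x => f (diagGL κ (l x))) ∈ A := by
  classical
  have key (l : X → (E →+* ℂ) → ℂˣ) (h : ∀ σ, (fun x => (l x σ : ℂ)) ∈ A)
      (φ : Module.Dual ℂ (ℂ ⊗[ℚ] W)) (m : ℂ ⊗[ℚ] W) :
      (fun x => φ ((diagGL κ (l x)).1 m)) ∈ A := by
    have hs : (fun x => φ ((diagGL κ (l x)).1 m)) = ∑ σ, (fun x => (l x σ : ℂ)) *
        algebraMap ℂ (X → ℂ) (coord κ m σ * φ ((coord κ).symm (Pi.single σ 1))) := by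
      funext x
      rw [dual_diagGL, Finset.sum_apply]
      simp
    rw [hs]
    exact A.sum_mem fun σ _ => A.mul_mem (h σ) (A.algebraMap_mem _)
  induction hf using Algebra.adjoin_induction with
  | mem f hf =>
    rcases hf with ⟨φ, w, rfl⟩ | ⟨φ, w, rfl⟩
    · exact key l h1 φ w
    · simp only [← map_inv]
      exact key (fun x => (l x)⁻¹) h2 φ w
  | algebraMap c => exact A.algebraMap_mem c
  | add f g _ _ hf hg => exact A.add_mem hf hg
  | mul f g _ _ hf hg => exact A.mul_mem hf hg

/-- An algebraic group that contains the compact part of a one-parameter group of diagonal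
operators contains the one-parameter group. -/
theorem IsAlgebraicOverQ.mem_cocharacters {G : Subgroup (GLC W)} (hG : IsAlgebraicOverQ G)
    (κ : W ≃ₗ[ℚ] E) (n : (E →+* ℂ) → ℤ)
    (h : ∀ z : ℂˣ, ‖(z : ℂ)‖ = 1 → diagGL κ (fun σ => z ^ n σ) ∈ G) :
    n ∈ cocharacters κ G := by
  obtain ⟨S, hS, hSG⟩ := hG
  intro z
  refine (hSG _).2 fun f hf => ?_
  refine eq_zero_of_mem_laurentOne (f := fun z => f (diagGL κ (fun σ => z ^ n σ)))
    (regularC_comp_diagGL laurentOne κ _ (fun σ => coe_zpow_mem_laurentOne _) (fun σ => ?_)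
      (regularC_of_regularQ (hS hf))) (fun z hz => (hSG _).1 (h z hz) f hf) z
  convert coe_zpow_mem_laurentOne (-(n σ)) using 3
  rw [zpow_neg]

/-! ## The norm-one torus -/

theorem det_mem_regularQ [FiniteDimensional ℚ W] :
    (fun u : GLC W => LinearMap.det u.1) ∈ regularQ W := by
  classical
  let b := Module.finBasis ℚ W
  have h : (fun u : GLC W => LinearMap.det u.1) = ∑ p : Equiv.Perm (Fin _),
      (Equiv.Perm.sign p : ℤ) • ∏ i, fun u => matrixCoeff (b.coord (p i)) (b i) u := by
    funext u
    rw [← LinearMap.det_toMatrix (Algebra.TensorProduct.basis ℂ b), Matrix.det_apply,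
      Finset.sum_apply]
    refine Finset.sum_congr rfl fun p _ => ?_
    rw [Pi.smul_apply, Finset.prod_apply, Units.smul_def]
    congr 1
    refine Finset.prod_congr rfl fun i _ => ?_
    rw [LinearMap.toMatrix_apply, matrixCoeff, Algebra.TensorProduct.basis_apply]
    generalize u.1 (1 ⊗ₜ b i) = x
    induction x with
    | zero => simp
    | tmul c w => simp
    | add x y hx hy => simp [hx, hy]
  rw [h]
  refine sum_mem fun p _ => zsmul_mem (prod_mem fun i _ => ?_) _
  exact Algebra.subset_adjoin (Or.inl ⟨_, _, rfl⟩)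

theorem eq_of_dual_baseChange_eq [FiniteDimensional ℚ W] (x y : ℂ ⊗[ℚ] W)
    (h : ∀ φ : Module.Dual ℚ W, LinearMap.liftBaseChange ℂ ((Algebra.linearMap ℚ ℂ) ∘ₗ φ) x =
      LinearMap.liftBaseChange ℂ ((Algebra.linearMap ℚ ℂ) ∘ₗ φ) y) : x = y := by
  let b := Module.finBasis ℚ W
  refine (Algebra.TensorProduct.basis ℂ b).repr.injective (Finsupp.ext fun i => ?_)
  have hb (x : ℂ ⊗[ℚ] W) : (Algebra.TensorProduct.basis ℂ b).repr x i =
      LinearMap.liftBaseChange ℂ ((Algebra.linearMap ℚ ℂ) ∘ₗ (b.coord i)) x := by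
    induction x with
    | zero => simp
    | tmul c w => simp
    | add x y hx hy => simp [hx, hy]
  rw [hb, hb, h]

theorem isAlgebraicOverQ_normOneTorus [FiniteDimensional ℚ W] (κ : W ≃ₗ[ℚ] E)
    (ρ : E →ₐ[ℚ] Module.End ℚ W) (hκ : ∀ a w, κ (ρ a w) = a * κ w) :
    IsAlgebraicOverQ (normOneTorus ρ) := by
  refine ⟨{(fun u : GLC W => LinearMap.det u.1) - 1} ∪ {f | ∃ a φ w, f =
    (fun u => matrixCoeff φ (ρ a w) u) - fun u => matrixCoeff (φ ∘ₗ ρ a) w u}, ?_, fun u => ?_⟩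
  · rintro f (rfl | ⟨a, φ, w, rfl⟩)
    · exact sub_mem det_mem_regularQ (one_mem _)
    · exact sub_mem (Algebra.subset_adjoin (Or.inl ⟨_, _, rfl⟩))
        (Algebra.subset_adjoin (Or.inl ⟨_, _, rfl⟩))
  have hcomp (a : E) (φ : Module.Dual ℚ W) (x : ℂ ⊗[ℚ] W) :
      LinearMap.liftBaseChange ℂ ((Algebra.linearMap ℚ ℂ) ∘ₗ (φ ∘ₗ ρ a)) x =
        LinearMap.liftBaseChange ℂ ((Algebra.linearMap ℚ ℂ) ∘ₗ φ) ((ρ a).baseChange ℂ x) := by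
    induction x with
    | zero => simp
    | tmul c w => simp
    | add x y hx hy => simp only [map_add, hx, hy]
  have hact (a : E) (x : ℂ ⊗[ℚ] W) :
      coord κ ((ρ a).baseChange ℂ x) = (fun σ => σ a) * coord κ x := by
    have := coord_actionC κ ρ hκ (1 ⊗ₜ a) x
    rw [actionC_tmul_apply, one_smul] at this
    rw [this]
    congr 1
    funext σ
    simp
  constructor
  · rintro hu f (rfl | ⟨a, φ, w, rfl⟩)
    · obtain ⟨l, rfl, hl⟩ := (mem_normOneTorus_iff κ ρ hκ u).1 hu
      simp only [Pi.sub_apply, Pi.one_apply, val_diagGL, det_diagEnd]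
      rw [← Units.coe_prod, hl]
      simp
    · obtain ⟨l, rfl, hl⟩ := (mem_normOneTorus_iff κ ρ hκ u).1 hu
      rw [Pi.sub_apply, sub_eq_zero, matrixCoeff, matrixCoeff, hcomp]
      congr 1
      refine (coord κ).injective ?_
      have : (1 : ℂ) ⊗ₜ[ℚ] ρ a w = (ρ a).baseChange ℂ (1 ⊗ₜ w) := by simp
      rw [this, val_diagGL, coord_diagEnd, hact, hact, coord_diagEnd, mul_left_comm]
  · intro hf
    obtain ⟨μ, hμ⟩ := exists_eq_diagEnd κ ρ hκ u.1 fun a x => by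
      induction x with
      | zero => simp
      | tmul c w =>
        have h : u.1 ((ρ a).baseChange ℂ (1 ⊗ₜ w)) = (ρ a).baseChange ℂ (u.1 (1 ⊗ₜ w)) := by
          refine eq_of_dual_baseChange_eq _ _ fun φ => ?_
          have := hf _ (Or.inr ⟨a, φ, w, rfl⟩)
          rw [Pi.sub_apply, sub_eq_zero, matrixCoeff, matrixCoeff, hcomp] at this
          simpa using this
        have hc : c ⊗ₜ[ℚ] w = c • (1 ⊗ₜ[ℚ] w) := by simp [TensorProduct.smul_tmul']
        rw [hc, map_smul, map_smul, h, map_smul, map_smul]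
      | add x y hx hy => simp only [map_add, hx, hy]
    obtain ⟨l, rfl, hl⟩ := exists_eq_diagGL κ u μ hμ
    refine (mem_normOneTorus_iff κ ρ hκ _).2 ⟨l, rfl, Units.ext ?_⟩
    have := hf _ (Or.inl rfl)
    simp only [Pi.sub_apply, Pi.one_apply, val_diagGL, det_diagEnd, sub_eq_zero] at this
    simpa using this

/-- The parametrization of the elements of product one of `(ℂˣ)^ι`. -/
def consInvProd {ι : Type*} {d : ℕ} (e : Fin (d + 1) ≃ ι) : (Fin d → ℂˣ) →* (ι → ℂˣ) where
  toFun z i := (Fin.cons (∏ j, z j)⁻¹ z : Fin (d + 1) → ℂˣ) (e.symm i)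
  map_one' := by
    funext i
    refine Fin.cases ?_ (fun j => ?_) (e.symm i) <;> simp
  map_mul' z w := by
    funext i
    rw [Pi.mul_apply]
    refine Fin.cases ?_ (fun j => ?_) (e.symm i)
    · simp [Finset.prod_mul_distrib, mul_comm]
    · simp

theorem consInvProd_succ {ι : Type*} {d : ℕ} (e : Fin (d + 1) ≃ ι) (z : Fin d → ℂˣ) (j : Fin d) :
    consInvProd e z (e j.succ) = z j := by
  simp [consInvProd]

theorem prod_consInvProd {ι : Type*} [Fintype ι] {d : ℕ} (e : Fin (d + 1) ≃ ι)
    (z : Fin d → ℂˣ) : ∏ i, consInvProd e z i = 1 := by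
  rw [← e.prod_comp, Fin.prod_univ_succ]
  simp only [consInvProd_succ]
  simp [consInvProd]

theorem exists_consInvProd_eq {ι : Type*} [Fintype ι] {d : ℕ} (e : Fin (d + 1) ≃ ι)
    (l : ι → ℂˣ) (hl : ∏ i, l i = 1) : ∃ z, consInvProd e z = l := by
  rw [← e.prod_comp, Fin.prod_univ_succ] at hl
  refine ⟨fun j => l (e j.succ), funext fun i => ?_⟩
  obtain ⟨k, rfl⟩ := e.surjective i
  refine Fin.cases ?_ (fun j => ?_) k
  · simp [consInvProd, eq_inv_of_mul_eq_one_left hl]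
  · rw [consInvProd_succ]

theorem isTorusOfDim_normOneTorus (κ : W ≃ₗ[ℚ] E) (ρ : E →ₐ[ℚ] Module.End ℚ W)
    (hκ : ∀ a w, κ (ρ a w) = a * κ w) (d : ℕ) (hd : Module.finrank ℚ E = d + 1) :
    IsTorusOfDim (normOneTorus ρ) d := by
  classical
  let e : Fin (d + 1) ≃ (E →+* ℂ) :=
    (Fintype.equivFinOfCardEq ((NumberField.Embeddings.card E ℂ).trans hd)).symm
  let ψ : (Fin d → ℂˣ) →* normOneTorus ρ := ((diagGL κ).comp (consInvProd e)).codRestrict _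
    fun z => (mem_normOneTorus_iff κ ρ hκ _).2 ⟨_, rfl, prod_consInvProd e z⟩
  have hψ (z) : (ψ z : GLC W) = diagGL κ (consInvProd e z) := rfl
  have hbij : Function.Bijective ψ := by
    constructor
    · intro z w h
      have h' := diagGL_injective κ (congrArg Subtype.val h)
      funext j
      rw [← consInvProd_succ e z, ← consInvProd_succ e w, h']
    · rintro ⟨u, hu⟩
      obtain ⟨l, rfl, hl⟩ := (mem_normOneTorus_iff κ ρ hκ u).1 hu
      obtain ⟨z, rfl⟩ := exists_consInvProd_eq e l hl
      exact ⟨z, rfl⟩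
  have hz (i : Fin d) : (fun z : Fin d → ℂˣ => (z i : ℂ)) ∈ laurent d :=
    Algebra.subset_adjoin (Or.inl ⟨i, rfl⟩)
  have hz' (i : Fin d) : (fun z : Fin d → ℂˣ => (((z i)⁻¹ : ℂˣ) : ℂ)) ∈ laurent d :=
    Algebra.subset_adjoin (Or.inr ⟨i, rfl⟩)
  refine ⟨MulEquiv.ofBijective ψ hbij, fun f hf => ?_, fun f hf => ?_⟩
  · refine regularC_comp_diagGL (laurent d) κ (fun z => consInvProd e z) (fun σ => ?_)
      (fun σ => ?_) hf
    · obtain ⟨k, rfl⟩ := e.surjective σ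
      refine Fin.cases ?_ (fun j => ?_) k
      · convert prod_mem (fun j _ => hz' j) (t := Finset.univ) using 1
        funext z
        simp [consInvProd, Finset.prod_apply]
      · simpa only [consInvProd_succ] using hz j
    · obtain ⟨k, rfl⟩ := e.surjective σ
      refine Fin.cases ?_ (fun j => ?_) k
      · convert prod_mem (fun j _ => hz j) (t := Finset.univ) using 1
        funext z
        simp [consInvProd, Finset.prod_apply]
      · simpa only [consInvProd_succ] using hz' j
  · suffices h : ∃ F ∈ regularC (ℂ ⊗[ℚ] W), ∀ z, f z = F (diagGL κ (consInvProd e z)) by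
      obtain ⟨F, hF, h⟩ := h
      refine ⟨F, hF, fun x => ?_⟩
      obtain ⟨z, rfl⟩ := (MulEquiv.ofBijective ψ hbij).surjective x
      rw [MulEquiv.symm_apply_apply, h]
      rfl
    have hcoeff (l : (E →+* ℂ) → ℂˣ) (σ : E →+* ℂ) :
        (LinearMap.proj σ ∘ₗ (coord κ).toLinearMap) ((diagGL κ l).1 ((coord κ).symm 1)) = l σ := by
      simp
    induction hf using Algebra.adjoin_induction with
    | mem f hf =>
      rcases hf with ⟨i, rfl⟩ | ⟨i, rfl⟩
      · refine ⟨_, Algebra.subset_adjoin (Or.inl ⟨LinearMap.proj (e i.succ) ∘ₗ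
          (coord κ).toLinearMap, (coord κ).symm 1, rfl⟩), fun z => ?_⟩
        simp only [hcoeff, consInvProd_succ]
      · refine ⟨_, Algebra.subset_adjoin (Or.inr ⟨LinearMap.proj (e i.succ) ∘ₗ
          (coord κ).toLinearMap, (coord κ).symm 1, rfl⟩), fun z => ?_⟩
        simp only [← map_inv, hcoeff, consInvProd_succ, Pi.inv_apply]
    | algebraMap c => exact ⟨_, Subalgebra.algebraMap_mem _ c, fun z => rfl⟩
    | add f g _ _ hf hg =>
      obtain ⟨F, hF, h⟩ := hf
      obtain ⟨F', hF', h'⟩ := hg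
      exact ⟨_, add_mem hF hF', fun z => by simp [h, h']⟩
    | mul f g _ _ hf hg =>
      obtain ⟨F, hF, h⟩ := hf
      obtain ⟨F', hF', h'⟩ := hg
      exact ⟨_, mul_mem hF hF', fun z => by simp [h, h']⟩

theorem laurent_comp_mulSingle {d : ℕ} (i : Fin d) {f : (Fin d → ℂˣ) → ℂ} (hf : f ∈ laurent d) :
    (fun z : ℂˣ => f (Pi.mulSingle i z)) ∈ laurentOne := by
  induction hf using Algebra.adjoin_induction with
  | mem f hf =>
    have h1 : (fun _ : ℂˣ => (1 : ℂ)) ∈ laurentOne := one_mem laurentOne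
    rcases hf with ⟨j, rfl⟩ | ⟨j, rfl⟩ <;> by_cases hij : j = i
    · subst hij
      simpa using coe_zpow_mem_laurentOne 1
    · simpa [hij] using h1
    · subst hij
      simpa using coe_zpow_mem_laurentOne (-1)
    · simpa [hij] using h1
  | algebraMap c => exact laurentOne.algebraMap_mem c
  | add f g _ _ hf hg => exact add_mem hf hg
  | mul f g _ _ hf hg => exact mul_mem hf hg

/-- The norm-one torus of a doubly transitive field is simple. -/
theorem eq_bot_or_eq_normOneTorus (hE : IsDoublyTransitiveField E) (κ : W ≃ₗ[ℚ] E)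
    (ρ : E →ₐ[ℚ] Module.End ℚ W) (hκ : ∀ a w, κ (ρ a w) = a * κ w) (S : Subgroup (GLC W))
    (hS : S ≤ normOneTorus ρ) {d : ℕ} (hd : IsQTorusOfDim S d) :
    S = ⊥ ∨ S = normOneTorus ρ := by
  obtain ⟨halg, φ, hφ, -⟩ := hd
  rcases isEmpty_or_nonempty (Fin d) with hempty | ⟨⟨i⟩⟩
  · left
    have := φ.symm.toEquiv.subsingleton
    exact Subgroup.eq_bot_of_subsingleton S
  right
  have hl (z : ℂˣ) : ∃ l, (φ (Pi.mulSingle i z) : GLC W) = diagGL κ l ∧ ∏ σ, l σ = 1 :=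
    (mem_normOneTorus_iff κ ρ hκ _).1 (hS (φ (Pi.mulSingle i z)).2)
  choose l hl hlprod using hl
  have hl1 : l 1 = 1 := diagGL_injective κ (by rw [← hl]; simp)
  have hn (σ : E →+* ℂ) : ∃ n : ℤ, ∀ z : ℂˣ, (l z σ : ℂ) = ((z ^ n : ℂˣ) : ℂ) := by
    refine exists_eq_zpow_of_mem_laurentOne ?_ (fun z => (l z σ).ne_zero) (by simp [hl1])
    have hreg := hφ _ (Algebra.subset_adjoin (Or.inl ⟨LinearMap.proj σ ∘ₗ
          (coord κ).toLinearMap, (coord κ).symm 1, rfl⟩))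
    convert laurent_comp_mulSingle i hreg using 1
    funext z
    simp [hl]
  choose n hn using hn
  have hln (z : ℂˣ) : l z = fun σ => z ^ n σ := funext fun σ => Units.ext (hn σ z)
  obtain ⟨w, hw1⟩ : ∃ w : ℂˣ, ∀ k : ℤ, w ^ k = 1 → k = 0 := by
    refine ⟨Units.mk0 2 two_ne_zero, fun k hk => ?_⟩
    have hk' := congrArg (fun u : ℂˣ => ‖(u : ℂ)‖) hk
    simp only [Units.val_zpow_eq_zpow_val, Units.val_mk0, norm_zpow, Units.val_one, norm_one,
      Complex.norm_ofNat] at hk'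
    exact (zpow_eq_one_iff_right₀ (by norm_num) (by norm_num)).1 hk'
  have hsum : ∑ σ, n σ = 0 := hw1 _ (by
    have := hlprod w
    rw [hln] at this
    rw [← this]
    exact zpow_sum _ _ _)
  have hn0 : n ≠ 0 := by
    rintro rfl
    have h1 : φ (Pi.mulSingle i w) = 1 := Subtype.ext (by
      rw [hl, hln]
      simp only [Pi.zero_apply, zpow_zero]
      exact map_one _)
    have h2 : w = 1 := by
      simpa using congrFun ((map_eq_one_iff φ φ.injective).1 h1) i
    exact one_ne_zero (hw1 1 (by rw [h2]; simp))
  refine le_antisymm hS (normOneTorus_le hE κ ρ hκ S halg.isGaloisStable n hn0 hsum fun z => ?_)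
  rw [← hln, ← hl]
  exact (φ (Pi.mulSingle i z)).2

theorem isSimpleQTorus_normOneTorus [FiniteDimensional ℚ W] (hE : IsDoublyTransitiveField E)
    (κ : W ≃ₗ[ℚ] E) (ρ : E →ₐ[ℚ] Module.End ℚ W) (hκ : ∀ a w, κ (ρ a w) = a * κ w)
    (hd : 1 < Module.finrank ℚ E) : IsSimpleQTorus (normOneTorus ρ) := by
  obtain ⟨d, hd'⟩ : ∃ d, Module.finrank ℚ E = d + 1 := ⟨_, (Nat.succ_pred (by omega)).symm⟩
  have ht := isTorusOfDim_normOneTorus κ ρ hκ d hd'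
  refine ⟨⟨d, isAlgebraicOverQ_normOneTorus κ ρ hκ, ht⟩, fun hbot => ?_,
    fun S hS ⟨k, hk⟩ => eq_bot_or_eq_normOneTorus hE κ ρ hκ S hS hk⟩
  obtain ⟨φ, -⟩ := ht
  rw [hbot] at φ
  have := φ.toEquiv.subsingleton
  have : Nonempty (Fin d) := ⟨⟨0, by omega⟩⟩
  have : Nontrivial ℂˣ := ⟨⟨1, -1, fun h => by
    have := congrArg Units.val h
    norm_num at this⟩⟩
  exact not_subsingleton (Fin d → ℂˣ) ‹_›

end AlgGroup

namespace AlgGroup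

variable {E : Type*} [Field E] [NumberField E] {W : Type*} [AddCommGroup W] [Module ℚ W]

/-- A faithful representation of `E` of dimension `[E : ℚ]` is isomorphic to `E`. -/
theorem exists_equivariant_equiv [FiniteDimensional ℚ W]
    (h : Module.finrank ℚ W = Module.finrank ℚ E) (ρ : E →ₐ[ℚ] Module.End ℚ W) :
    ∃ κ : W ≃ₗ[ℚ] E, ∀ a w, κ (ρ a w) = a * κ w := by
  have hpos : 0 < Module.finrank ℚ W := h ▸ Module.finrank_pos
  have := Module.nontrivial_of_finrank_pos hpos
  obtain ⟨w, hw⟩ := exists_ne (0 : W)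
  let f : E →ₗ[ℚ] W := LinearMap.applyₗ w ∘ₗ ρ.toLinearMap
  have hf (a : E) : f a = ρ a w := rfl
  have hinj : Function.Injective f := by
    refine (injective_iff_map_eq_zero f).2 fun a ha => ?_
    by_contra h0
    refine hw ?_
    have := congrArg (ρ a⁻¹) ha
    rwa [hf, ← Module.End.mul_apply, ← map_mul, inv_mul_cancel₀ h0, map_one, map_zero] at this
  refine ⟨(f.linearEquivOfInjective hinj h.symm).symm, fun a w => ?_⟩
  obtain ⟨b, rfl⟩ := (f.linearEquivOfInjective hinj h.symm).surjective w
  rw [LinearEquiv.symm_apply_eq, LinearEquiv.symm_apply_apply]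
  simp [hf]

/-- The basis of `W_ℂ` that consists of common eigenvectors of `E`. -/
def eigenbasis (κ : W ≃ₗ[ℚ] E) : Module.Basis (E →+* ℂ) ℂ (ℂ ⊗[ℚ] W) :=
  Module.Basis.ofEquivFun (coord κ)

theorem coord_eigenbasis [DecidableEq (E →+* ℂ)] (κ : W ≃ₗ[ℚ] E) (σ τ : E →+* ℂ) :
    coord κ (eigenbasis κ σ) τ = if σ = τ then 1 else 0 := by
  simp [eigenbasis, Pi.single_apply, eq_comm]

theorem diagEnd_eigenbasis (κ : W ≃ₗ[ℚ] E) (μ : (E →+* ℂ) → ℂ) (σ : E →+* ℂ) :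
    diagEnd κ μ (eigenbasis κ σ) = μ σ • eigenbasis κ σ := by
  classical
  refine (coord κ).injective (funext fun τ => ?_)
  rw [coord_diagEnd, map_smul, Pi.mul_apply, Pi.smul_apply, smul_eq_mul, coord_eigenbasis]
  split_ifs with h
  · rw [h]
  · simp

theorem galois_eigenbasis (κ : W ≃ₗ[ℚ] E) (t : ℂ ≃+* ℂ) (σ : E →+* ℂ) :
    galois t (eigenbasis κ σ) = eigenbasis κ (embeddingPerm E t σ) := by
  classical
  refine (coord κ).injective (funext fun τ => ?_)
  rw [coord_galois', coord_eigenbasis, coord_eigenbasis]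
  simp [Equiv.eq_symm_apply, apply_ite t]

end AlgGroup

/-! ## The Hodge cocharacter -/

namespace ComplexTorus

variable {V : Type*} [NormedAddCommGroup V] [NormedSpace ℂ V] [FiniteDimensional ℂ V]
variable (Λ : Submodule ℤ V) [DiscreteTopology Λ] [IsZLattice ℝ Λ]

theorem finrank_H1Q : Module.finrank ℚ (H1Q Λ) = 2 * Module.finrank ℂ V := by
  rw [Module.finrank_baseChange, ZLattice.rank ℝ Λ, finrank_real_of_complex]

instance : FiniteDimensional ℚ (H1Q Λ) := by
  have := ZLattice.module_finite ℝ Λ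
  infer_instance

theorem complexEquiv_tmul (z : ℂ) (x : H1Q Λ) :
    complexEquiv Λ (z ⊗ₜ x) = z ⊗ₜ incl Λ x := by
  have h : (TensorProduct.AlgebraTensorModule.cancelBaseChange ℚ ℝ ℂ ℂ (H1Q Λ)).symm (z ⊗ₜ x) =
      z ⊗ₜ[ℝ] ((1 : ℝ) ⊗ₜ[ℚ] x) := by
    rw [LinearEquiv.symm_apply_eq]
    simp
  rw [complexEquiv, LinearEquiv.trans_apply, h]
  rfl

theorem complexEquiv_complexify (u : Module.End ℝ V) (x : H1C Λ) :
    complexEquiv Λ (complexify Λ u x) = u.baseChange ℂ (complexEquiv Λ x) := by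
  change complexEquiv Λ ((complexEquiv Λ).symm.conj (u.baseChange ℂ) x) = _
  simp [LinearEquiv.conj_apply]

theorem complexify_eq_baseChange (f : V →ₗ[ℂ] V) (u : Module.End ℚ (H1Q Λ))
    (h : ∀ x, f (incl Λ x) = incl Λ (u x)) :
    complexify Λ (f.restrictScalars ℝ) = u.baseChange ℂ := by
  refine LinearMap.ext fun x => (complexEquiv Λ).injective ?_
  rw [complexEquiv_complexify]
  induction x using TensorProduct.induction_on with
  | zero => simp
  | tmul z x => simp [complexEquiv_tmul, h]
  | add x y hx hy => simp only [map_add, hx, hy]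

theorem mulOperator_comm (z : ℂ) (u : Module.End ℚ (H1Q Λ)) (hu : u ∈ endAlgebra Λ)
    (x : H1C Λ) : mulOperator Λ z (u.baseChange ℂ x) = u.baseChange ℂ (mulOperator Λ z x) := by
  obtain ⟨f, hf⟩ := hu
  have h : Commute (Algebra.lsmul ℝ ℝ V z : Module.End ℝ V) (f.restrictScalars ℝ) :=
    LinearMap.ext fun v => by simp
  have h' := h.map (complexify Λ)
  rw [complexify_eq_baseChange Λ f u hf] at h'
  exact LinearMap.congr_fun h' x

theorem mulOperator_eq (z : ℂ) (x : H1C Λ) :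
    mulOperator Λ z x = (z.re : ℂ) • x + (z.im : ℂ) • J Λ x := by
  refine (complexEquiv Λ).injective ?_
  have h (z : ℂ) : complexEquiv Λ (mulOperator Λ z x) =
      (Algebra.lsmul ℝ ℝ V z).baseChange ℂ (complexEquiv Λ x) :=
    complexEquiv_complexify Λ _ x
  rw [map_add, map_smul, map_smul, J, h, h]
  generalize complexEquiv Λ x = y
  induction y with
  | zero => simp
  | tmul c v =>
    have hz : z • v = z.re • v + z.im • Complex.I • v := by
      conv_lhs => rw [← Complex.re_add_im z]
      rw [add_smul, mul_smul]
      rfl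
    simp only [LinearMap.baseChange_tmul, Algebra.lsmul_coe, hz, TensorProduct.tmul_add,
      TensorProduct.tmul_smul]
    rfl
  | add x y hx hy => simp only [map_add, hx, hy, smul_add]; abel

theorem J_sq : J Λ * J Λ = -1 := by
  refine LinearMap.ext fun x => ?_
  rw [J, ← map_mul, Complex.I_mul_I, mulOperator_eq]
  simp

theorem trace_J_im : (LinearMap.trace ℂ _ (J Λ)).im = 0 := by
  have : LinearMap.trace ℂ _ (J Λ) =
      algebraMap ℝ ℂ (LinearMap.trace ℝ V (Algebra.lsmul ℝ ℝ V Complex.I)) := by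
    change LinearMap.trace ℂ _ ((complexEquiv Λ).symm.conj
      ((Algebra.lsmul ℝ ℝ V Complex.I).baseChange ℂ)) = _
    rw [LinearMap.trace_conj', LinearMap.trace_baseChange]
  rw [this]
  simp

variable {E : Type*} [Field E] [NumberField E]

/-- In the coordinates given by the embeddings of `E`, the operators `h(z)` with `|z| = 1` form
the compact part of a one-parameter group with exponents `±1` and determinant one. -/
theorem exists_hodge_cocharacter (κ : H1Q Λ ≃ₗ[ℚ] E) (ρ : E →ₐ[ℚ] Module.End ℚ (H1Q Λ))
    (hκ : ∀ a w, κ (ρ a w) = a * κ w) (hρ : ∀ a, ρ a ∈ endAlgebra Λ) :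
    ∃ n : (E →+* ℂ) → ℤ, ∑ σ, n σ = 0 ∧
      (∀ σ, (n σ = 1 ∧ AlgGroup.eigenbasis κ σ ∈ Hm10 Λ) ∨
        (n σ = -1 ∧ AlgGroup.eigenbasis κ σ ∈ H0m1 Λ)) ∧
      ∀ z : ℂˣ, ‖(z : ℂ)‖ = 1 → hodgeHom Λ z = AlgGroup.diagGL κ (fun σ => z ^ n σ) := by
  classical
  obtain ⟨μ, hμ⟩ := AlgGroup.exists_eq_diagEnd κ ρ hκ (J Λ)
    fun a x => mulOperator_comm Λ _ _ (hρ a) x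
  have hJ (σ : E →+* ℂ) : J Λ (AlgGroup.eigenbasis κ σ) = μ σ • AlgGroup.eigenbasis κ σ := by
    rw [hμ, AlgGroup.diagEnd_eigenbasis]
  have hμσ (σ : E →+* ℂ) : μ σ = Complex.I ∨ μ σ = -Complex.I := by
    rw [← sq_eq_sq_iff_eq_or_eq_neg, Complex.I_sq]
    have h := LinearMap.congr_fun (J_sq Λ) (AlgGroup.eigenbasis κ σ)
    rw [Module.End.mul_apply, hJ, map_smul, hJ, smul_smul] at h
    have h' := congrFun (congrArg (AlgGroup.coord κ) h) σ
    simpa [AlgGroup.coord_eigenbasis, ← sq] using h'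
  let n : (E →+* ℂ) → ℤ := fun σ => if μ σ = Complex.I then 1 else -1
  have hn (σ : E →+* ℂ) : (n σ = 1 ∧ μ σ = Complex.I) ∨ (n σ = -1 ∧ μ σ = -Complex.I) := by
    by_cases h : μ σ = Complex.I
    · left; simp [n, h]
    · right
      exact ⟨by simp [n, h], (hμσ σ).resolve_left h⟩
  refine ⟨n, ?_, fun σ => ?_, fun z hz => ?_⟩
  · have h := trace_J_im Λ
    rw [hμ, AlgGroup.trace_diagEnd] at h
    have hμn (σ : E →+* ℂ) : (μ σ).im = n σ := by
      rcases hn σ with ⟨h1, h2⟩ | ⟨h1, h2⟩ <;> simp [h1, h2]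
    rw [Complex.im_sum] at h
    simp only [hμn] at h
    exact_mod_cast h
  · refine (hn σ).imp (fun h => ⟨h.1, ?_⟩) fun h => ⟨h.1, ?_⟩
    · rw [Hm10, Module.End.mem_eigenspace_iff, hJ, h.2]
    · rw [H0m1, Module.End.mem_eigenspace_iff, hJ, h.2]
  · refine (AlgGroup.eq_diagGL_iff κ _ _).2 fun x σ => ?_
    change AlgGroup.coord κ (mulOperator Λ z x) σ = _
    rw [mulOperator_eq, map_add, map_smul, map_smul, hμ, AlgGroup.coord_diagEnd]
    simp only [Pi.add_apply, Pi.smul_apply, Pi.mul_apply, smul_eq_mul]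
    rw [← mul_assoc, ← add_mul]
    congr 1
    rcases hn σ with ⟨h1, h2⟩ | ⟨h1, h2⟩
    · rw [h1, h2, zpow_one, Complex.re_add_im]
    · rw [h1, h2, zpow_neg_one, Units.val_inv_eq_inv_val, Complex.inv_eq_conj hz]
      apply Complex.ext <;> simp

end ComplexTorus

/-! ## Galois stable spaces of alternating forms -/

namespace AlgGroup

variable {E : Type*} [Field E] [NumberField E] {W : Type*} [AddCommGroup W] [Module ℚ W]

/-- The semilinear action of `Aut(ℂ)` on the bilinear forms on `W_ℂ`. -/
def galoisForm (t : ℂ ≃+* ℂ) (φ : LinearMap.BilinForm ℂ (ℂ ⊗[ℚ] W)) :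
    LinearMap.BilinForm ℂ (ℂ ⊗[ℚ] W) :=
  LinearMap.mk₂ ℂ (fun x y => t (φ ((galois t).symm x) ((galois t).symm y)))
    (fun x x' y => by simp) (fun c x y => by simp [galois_symm_smul])
    (fun x y y' => by simp) (fun c x y => by simp [galois_symm_smul])

@[simp]
theorem galoisForm_apply (t : ℂ ≃+* ℂ) (φ : LinearMap.BilinForm ℂ (ℂ ⊗[ℚ] W))
    (x y : ℂ ⊗[ℚ] W) :
    galoisForm t φ x y = t (φ ((galois t).symm x) ((galois t).symm y)) := rfl

theorem galois_symm (t : ℂ ≃+* ℂ) (x : ℂ ⊗[ℚ] W) : (galois t).symm x = galois t.symm x := by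
  induction x with
  | zero => simp
  | tmul c w => simp
  | add x y hx hy => simp only [map_add, hx, hy]

/-- The space of forms `N` is stable under `Aut(ℂ)`. -/
def IsGaloisStableSpace (N : Submodule ℂ (LinearMap.BilinForm ℂ (ℂ ⊗[ℚ] W))) : Prop :=
  ∀ (t : ℂ ≃+* ℂ), ∀ φ ∈ N, galoisForm t φ ∈ N

theorem isGaloisStableSpace_span (H : Set (LinearMap.BilinForm ℚ W)) :
    IsGaloisStableSpace
      (Submodule.span ℂ ((fun B => LinearMap.BilinForm.baseChange ℂ B) '' H)) := by
  intro t φ hφ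
  induction hφ using Submodule.span_induction with
  | mem φ hφ =>
    obtain ⟨B, hB, rfl⟩ := hφ
    suffices h : galoisForm t (LinearMap.BilinForm.baseChange ℂ B) =
        LinearMap.BilinForm.baseChange ℂ B by
      simp only [h]
      exact Submodule.subset_span (Set.mem_image_of_mem _ hB)
    refine LinearMap.ext₂ fun x y => ?_
    rw [galoisForm_apply]
    induction x with
    | zero => simp
    | add x x' hx hx' => simp only [map_add, LinearMap.add_apply, hx, hx']
    | tmul c w =>
      induction y with
      | zero => simp
      | add y y' hy hy' => simp only [map_add, hy, hy']
      | tmul d v => simp [Algebra.smul_def]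
  | zero =>
    have h : galoisForm t (0 : LinearMap.BilinForm ℂ (ℂ ⊗[ℚ] W)) = 0 :=
      LinearMap.ext₂ fun x y => by simp
    rw [h]
    exact Submodule.zero_mem _
  | add φ ψ _ _ hφ hψ =>
    convert add_mem hφ hψ using 1
    exact LinearMap.ext₂ fun x y => by simp
  | smul c φ _ hφ =>
    convert Submodule.smul_mem _ (t c) hφ using 1
    exact LinearMap.ext₂ fun x y => by simp

/-- The action of a linear operator on bilinear forms, `(u φ)(x, y) = φ(u⁻¹ x, u⁻¹ y)`. -/
def formAction (u : GLC W) (φ : LinearMap.BilinForm ℂ (ℂ ⊗[ℚ] W)) :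
    LinearMap.BilinForm ℂ (ℂ ⊗[ℚ] W) :=
  LinearMap.BilinForm.comp φ (u⁻¹).1 (u⁻¹).1

@[simp]
theorem formAction_apply (u : GLC W) (φ : LinearMap.BilinForm ℂ (ℂ ⊗[ℚ] W))
    (x y : ℂ ⊗[ℚ] W) : formAction u φ x y = φ ((u⁻¹).1 x) ((u⁻¹).1 y) := rfl

theorem formAction_mul (u v : GLC W) (φ : LinearMap.BilinForm ℂ (ℂ ⊗[ℚ] W)) :
    formAction (u * v) φ = formAction u (formAction v φ) :=
  LinearMap.ext₂ fun x y => by simp [mul_inv_rev]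

theorem formAction_one (φ : LinearMap.BilinForm ℂ (ℂ ⊗[ℚ] W)) : formAction 1 φ = φ :=
  LinearMap.ext₂ fun x y => by simp

/-- The stabilizer in `GL(W_ℂ)` of a space of bilinear forms. -/
def formStabilizer (N : Submodule ℂ (LinearMap.BilinForm ℂ (ℂ ⊗[ℚ] W))) : Subgroup (GLC W) where
  carrier := {u | ∀ φ, formAction u φ ∈ N ↔ φ ∈ N}
  one_mem' φ := by rw [formAction_one]
  mul_mem' {u v} hu hv φ := by rw [formAction_mul, hu, hv]
  inv_mem' {u} hu φ := by
    rw [← hu, ← formAction_mul, mul_inv_cancel, formAction_one]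

theorem isGaloisStable_formStabilizer {N : Submodule ℂ (LinearMap.BilinForm ℂ (ℂ ⊗[ℚ] W))}
    (hN : IsGaloisStableSpace N) : IsGaloisStable (formStabilizer N) := by
  intro t u hu φ
  have h1 (t : ℂ ≃+* ℂ) (φ : LinearMap.BilinForm ℂ (ℂ ⊗[ℚ] W)) : galoisForm t (galoisForm t.symm φ) = φ :=
    LinearMap.ext₂ fun x y => by simp [galois_symm]
  have h2 (t : ℂ ≃+* ℂ) (φ : LinearMap.BilinForm ℂ (ℂ ⊗[ℚ] W)) : galoisForm t φ ∈ N ↔ φ ∈ N :=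
    ⟨fun h => by
      have h' := hN t.symm _ h
      rwa [show galoisForm t.symm (galoisForm t φ) = φ from h1 t.symm φ] at h', hN t φ⟩
  have h3 : formAction (galoisGL t u) φ = galoisForm t (formAction u (galoisForm t.symm φ)) := by
    refine LinearMap.ext₂ fun x y => ?_
    simp only [formAction_apply, galoisForm_apply, ← map_inv, val_galoisGL, galoisEnd_apply]
    simp [galois_symm t.symm]
  rw [h3, h2, hu, h2]

theorem formAction_diagGL (κ : W ≃ₗ[ℚ] E) (l : (E →+* ℂ) → ℂˣ)
    (φ : LinearMap.BilinForm ℂ (ℂ ⊗[ℚ] W)) (σ τ : E →+* ℂ) :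
    formAction (diagGL κ l) φ (eigenbasis κ σ) (eigenbasis κ τ) =
      ((l σ : ℂ)⁻¹ * (l τ : ℂ)⁻¹) * φ (eigenbasis κ σ) (eigenbasis κ τ) := by
  rw [formAction_apply, ← map_inv, val_diagGL, diagEnd_eigenbasis, diagEnd_eigenbasis]
  simp
  ring

theorem galoisForm_eigenbasis (κ : W ≃ₗ[ℚ] E) (t : ℂ ≃+* ℂ)
    (φ : LinearMap.BilinForm ℂ (ℂ ⊗[ℚ] W)) (σ τ : E →+* ℂ) :
    galoisForm t φ (eigenbasis κ (embeddingPerm E t σ)) (eigenbasis κ (embeddingPerm E t τ)) =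
      t (φ (eigenbasis κ σ) (eigenbasis κ τ)) := by
  rw [galoisForm_apply, ← galois_eigenbasis, ← galois_eigenbasis, LinearEquiv.symm_apply_apply,
    LinearEquiv.symm_apply_apply]

/-- A product-one vector that separates the pair `σ, τ`. -/
theorem exists_separating {ι : Type*} [Fintype ι] [DecidableEq ι] (σ τ : ι) (h : σ ≠ τ) :
    ∃ (l : ι → ℂˣ) (a b : ℂ), ∏ i, l i = 1 ∧ a ≠ 0 ∧ a - b ≠ 0 ∧ a + b ≠ 0 ∧
      ∀ i, ((l i : ℂ))⁻¹ = if i = σ ∨ i = τ then a else b := by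
  let k := (Finset.univ.filter fun i => ¬ (i = σ ∨ i = τ)).card
  let u : ℂˣ := Units.mk0 2 two_ne_zero
  have hcard : (Finset.univ.filter fun i => i = σ ∨ i = τ).card = 2 := by
    rw [← Finset.card_pair h]
    congr 1
    ext i
    simp
  have ha1 : ‖((u ^ k : ℂˣ) : ℂ)⁻¹‖ ≤ 1 := by
    rw [norm_inv]
    refine inv_le_one_of_one_le₀ ?_
    simp only [u, Units.val_pow_eq_pow_val, Units.val_mk0, norm_pow, Complex.norm_ofNat]
    exact one_le_pow₀ (by norm_num)
  refine ⟨fun i => if i = σ ∨ i = τ then u ^ k else (u ^ 2)⁻¹, ((u ^ k : ℂˣ) : ℂ)⁻¹, 4, ?_, ?_, ?_,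
    ?_, fun i => ?_⟩
  · rw [Finset.prod_ite, Finset.prod_const, Finset.prod_const, hcard, ← pow_mul, inv_pow, ← pow_mul,
      mul_comm 2, mul_inv_cancel]
  · exact inv_ne_zero (Units.ne_zero _)
  · intro h
    rw [sub_eq_zero.1 h] at ha1
    norm_num at ha1
  · intro h
    rw [eq_neg_of_add_eq_zero_left h] at ha1
    norm_num at ha1
  · by_cases hi : i = σ ∨ i = τ
    · simp only [hi, if_true]
    · simp only [hi, if_false, u]
      norm_num

/-- A nonzero space of alternating forms that is stable under `Aut(ℂ)` and the norm-one torus of a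
doubly transitive field contains all alternating forms. -/
theorem mem_of_isAlt (hE : IsDoublyTransitiveField E) (κ : W ≃ₗ[ℚ] E)
    (N : Submodule ℂ (LinearMap.BilinForm ℂ (ℂ ⊗[ℚ] W))) (hgal : IsGaloisStableSpace N)
    (halt : ∀ φ ∈ N, φ.IsAlt)
    (hstab : ∀ l : (E →+* ℂ) → ℂˣ, ∏ σ, l σ = 1 → ∀ φ ∈ N, formAction (diagGL κ l) φ ∈ N)
    (hN : N ≠ ⊥) (χ : LinearMap.BilinForm ℂ (ℂ ⊗[ℚ] W)) (hχ : χ.IsAlt) : χ ∈ N := by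
  classical
  obtain ⟨φ, hφ, hφ0⟩ := Submodule.exists_mem_ne_zero_of_ne_bot hN
  obtain ⟨σ, τ, hστ⟩ : ∃ σ τ, φ (eigenbasis κ σ) (eigenbasis κ τ) ≠ 0 := by
    by_contra! h
    exact hφ0 ((eigenbasis κ).ext fun σ => (eigenbasis κ).ext fun τ => by simp [h])
  have hne : σ ≠ τ := by
    rintro rfl
    exact hστ (halt φ hφ _)
  obtain ⟨ψ, hψ, hψ1, hψ0⟩ : ∃ ψ ∈ N, ψ (eigenbasis κ σ) (eigenbasis κ τ) ≠ 0 ∧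
      ∀ α β, ¬ (α = σ ∧ β = τ ∨ α = τ ∧ β = σ) → ψ (eigenbasis κ α) (eigenbasis κ β) = 0 := by
    obtain ⟨l, a, b, hl, ha, hab, hab', hlab⟩ := exists_separating σ τ hne
    let T := formAction (diagGL κ l)
    have hT : ∀ φ ∈ N, T φ ∈ N := hstab l hl
    refine ⟨T (T φ) - (a * b + b * b) • T φ + (a * b * b * b) • φ,
      add_mem (sub_mem (hT _ (hT _ hφ)) (N.smul_mem _ (hT _ hφ))) (N.smul_mem _ hφ), ?_, ?_⟩
    · simp only [LinearMap.add_apply, LinearMap.sub_apply, LinearMap.smul_apply, T,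
        formAction_diagGL, hlab, true_or, or_true, if_true, smul_eq_mul]
      have : a * a * (a * a * φ (eigenbasis κ σ) (eigenbasis κ τ)) -
          (a * b + b * b) * (a * a * φ (eigenbasis κ σ) (eigenbasis κ τ)) +
          a * b * b * b * φ (eigenbasis κ σ) (eigenbasis κ τ) =
          a * (a - b) * (a - b) * (a + b) * φ (eigenbasis κ σ) (eigenbasis κ τ) := by ring
      rw [this]
      exact mul_ne_zero (mul_ne_zero (mul_ne_zero (mul_ne_zero ha hab) hab) hab') hστ
    · intro α β hαβ
      simp only [LinearMap.add_apply, LinearMap.sub_apply, LinearMap.smul_apply, T,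
        formAction_diagGL, hlab, smul_eq_mul]
      by_cases hα : α = σ ∨ α = τ <;> by_cases hβ : β = σ ∨ β = τ
      · have : α = β := by grind
        subst this
        simp [halt φ hφ (eigenbasis κ α)]
      all_goals simp only [hα, hβ, if_true, if_false]; ring
  have hψ2 : ψ (eigenbasis κ τ) (eigenbasis κ σ) = -ψ (eigenbasis κ σ) (eigenbasis κ τ) :=
    ((halt ψ hψ).neg_eq _ _).symm
  have hF (σ' τ' : E →+* ℂ) : ∃ F ∈ N, ∀ α β, F (eigenbasis κ α) (eigenbasis κ β) =
      (if α = σ' ∧ β = τ' then 1 else 0) - (if α = τ' ∧ β = σ' then 1 else 0) := by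
    by_cases hne' : σ' = τ'
    · subst hne'
      exact ⟨0, zero_mem N, fun α β => by simp⟩
    obtain ⟨t, h1, h2⟩ := hE σ τ σ' τ' hne hne'
    refine ⟨(t (ψ (eigenbasis κ σ) (eigenbasis κ τ)))⁻¹ • galoisForm t ψ,
      N.smul_mem _ (hgal t ψ hψ), fun α β => ?_⟩
    obtain ⟨α, rfl⟩ := (embeddingPerm E t).surjective α
    obtain ⟨β, rfl⟩ := (embeddingPerm E t).surjective β
    obtain rfl : embeddingPerm E t σ = σ' := h1
    obtain rfl : embeddingPerm E t τ = τ' := h2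
    have ht : t (ψ (eigenbasis κ σ) (eigenbasis κ τ)) ≠ 0 := by simpa using hψ1
    rw [LinearMap.smul_apply, LinearMap.smul_apply, galoisForm_eigenbasis, smul_eq_mul]
    simp only [(embeddingPerm E t).injective.eq_iff]
    by_cases hA : α = σ ∧ β = τ
    · obtain ⟨rfl, rfl⟩ := hA
      simp [hne, ht]
    by_cases hB : α = τ ∧ β = σ
    · obtain ⟨rfl, rfl⟩ := hB
      simp [hne.symm, ht, hψ2]
    · rw [hψ0 α β (not_or.2 ⟨hA, hB⟩)]
      simp [hA, hB]
  choose F hFN hF using hF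
  have hχF : χ = ∑ σ, ∑ τ, (2⁻¹ * χ (eigenbasis κ σ) (eigenbasis κ τ)) • F σ τ := by
    refine (eigenbasis κ).ext fun α => (eigenbasis κ).ext fun β => ?_
    simp only [LinearMap.sum_apply, LinearMap.smul_apply, hF, smul_eq_mul, mul_sub,
      Finset.sum_sub_distrib, ite_and, mul_ite, mul_one, mul_zero, Finset.sum_ite_eq,
      Finset.sum_ite_irrel, Finset.sum_const_zero, Finset.mem_univ, if_true]
    rw [← hχ.neg_eq (eigenbasis κ α) (eigenbasis κ β)]
    ring
  rw [hχF]
  exact sum_mem fun σ _ => sum_mem fun τ _ => N.smul_mem _ (hFN σ τ)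

/-- A rational form is in a rational subspace as soon as it is so over `ℂ`. -/
theorem mem_of_baseChange_mem (H : Submodule ℚ (LinearMap.BilinForm ℚ W))
    (B : LinearMap.BilinForm ℚ W)
    (hB : B.baseChange ℂ ∈
      Submodule.span ℂ ((fun B => LinearMap.BilinForm.baseChange ℂ B) '' (H : Set _))) :
    B ∈ H := by
  obtain ⟨π, hπ⟩ := LinearMap.exists_leftInverse_of_injective (Algebra.linearMap ℚ ℂ)
    (LinearMap.ker_eq_bot.2 (algebraMap ℚ ℂ).injective)
  have hπ' (q : ℚ) : π (q : ℂ) = q := by simpa using LinearMap.congr_fun hπ q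
  have key : ∀ φ ∈ Submodule.span ℂ
      ((fun B => LinearMap.BilinForm.baseChange ℂ B) '' (H : Set (LinearMap.BilinForm ℚ W))),
      ∀ c : ℂ, ∃ B ∈ H, ∀ x y : W, B x y = π (c * φ (1 ⊗ₜ x) (1 ⊗ₜ y)) := by
    intro φ hφ
    induction hφ using Submodule.span_induction with
    | mem φ hφ =>
      obtain ⟨B, hB, rfl⟩ := hφ
      refine fun c => ⟨π c • B, H.smul_mem _ hB, fun x y => ?_⟩
      have : c * (B.baseChange ℂ (1 ⊗ₜ x) (1 ⊗ₜ y)) = B x y • c := by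
        simp [Algebra.smul_def, mul_comm]
      simp only [this, map_smul, LinearMap.smul_apply, smul_eq_mul, mul_comm]
    | zero => exact fun c => ⟨0, H.zero_mem, fun x y => by simp⟩
    | add φ ψ _ _ hφ hψ =>
      intro c
      obtain ⟨B, hB, h⟩ := hφ c
      obtain ⟨B', hB', h'⟩ := hψ c
      exact ⟨B + B', H.add_mem hB hB', fun x y => by simp [h, h', mul_add]⟩
    | smul d φ _ hφ =>
      intro c
      obtain ⟨B, hB, h⟩ := hφ (c * d)
      exact ⟨B, hB, fun x y => by simp [h, mul_assoc]⟩
  obtain ⟨B', hB', h⟩ := key _ hB 1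
  obtain rfl : B = B' := LinearMap.ext₂ fun x y => by
    rw [h]
    simp [Algebra.smul_def, hπ']
  exact hB'

end AlgGroup

namespace ComplexTorus

section Forms

variable {V : Type*} [NormedAddCommGroup V] {Λ : Submodule ℤ V}

theorem isAlt_of_mem_complexSpan {H : Submodule ℚ (LinearMap.BilinForm ℚ (H1Q Λ))}
    (hH : H ≤ H2Q Λ) {φ : LinearMap.BilinForm ℂ (H1C Λ)} (hφ : φ ∈ complexSpan H) :
    φ.IsAlt := by
  suffices h : complexSpan H ≤ H2C Λ from h hφ
  refine Submodule.span_le.2 ?_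
  rintro _ ⟨B, hB, rfl⟩ x
  have hB' : B.IsAlt := hH hB
  have hneg (x y : H1C Λ) : B.baseChange ℂ x y = -B.baseChange ℂ y x := by
    induction x using TensorProduct.induction_on with
    | zero => simp
    | add x x' hx hx' => simp only [map_add, LinearMap.add_apply, hx, hx', neg_add]
    | tmul c w =>
      induction y using TensorProduct.induction_on with
      | zero => simp
      | add y y' hy hy' => simp only [map_add, LinearMap.add_apply, hy, hy', neg_add]
      | tmul d v =>
        rw [LinearMap.BilinForm.baseChange_tmul, LinearMap.BilinForm.baseChange_tmul,
          ← hB'.neg_eq v w, mul_comm, neg_smul]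
  have := hneg x x
  exact self_eq_neg.1 this

theorem complexSpan_ne_bot {H : Submodule ℚ (LinearMap.BilinForm ℚ (H1Q Λ))} (hH : H ≠ ⊥) :
    complexSpan H ≠ ⊥ := by
  obtain ⟨B, hB, hB0⟩ := Submodule.exists_mem_ne_zero_of_ne_bot hH
  intro h
  have : B.baseChange ℂ ∈ complexSpan H := Submodule.subset_span (Set.mem_image_of_mem _ hB)
  rw [h, Submodule.mem_bot] at this
  exact hB0 ((LinearMap.BilinForm.baseChange_eq_zero_iff _).1 this)

theorem H2Q_ne_bot (h : 1 < Module.finrank ℚ (H1Q Λ)) : H2Q Λ ≠ ⊥ := by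
  have : FiniteDimensional ℚ (H1Q Λ) := Module.finite_of_finrank_pos (by omega)
  let b := Module.finBasis ℚ (H1Q Λ)
  let i : Fin (Module.finrank ℚ (H1Q Λ)) := ⟨0, by omega⟩
  let j : Fin (Module.finrank ℚ (H1Q Λ)) := ⟨1, h⟩
  have hij : i ≠ j := by simp [i, j]
  let B : LinearMap.BilinForm ℚ (H1Q Λ) := LinearMap.mk₂ ℚ
    (fun x y => b.coord i x * b.coord j y - b.coord j x * b.coord i y)
    (fun x x' y => by simp only [map_add]; ring)
    (fun c x y => by simp only [map_smul, smul_eq_mul]; ring)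
    (fun x y y' => by simp only [map_add]; ring)
    (fun c x y => by simp only [map_smul, smul_eq_mul]; ring)
  have hB (x y) : B x y = b.coord i x * b.coord j y - b.coord j x * b.coord i y := rfl
  intro hbot
  have hmem : B ∈ H2Q Λ := fun x => by rw [hB]; ring
  rw [hbot, Submodule.mem_bot] at hmem
  have h1 := hB (b i) (b j)
  rw [hmem] at h1
  simp [hij, hij.symm] at h1

/-- A nonzero rational space of alternating forms that is stable under the norm-one torus is the
space of all alternating forms. -/
theorem H2C_le_complexSpan {E : Type*} [Field E] [NumberField E]
    (hE : IsDoublyTransitiveField E) (κ : H1Q Λ ≃ₗ[ℚ] E)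
    {H : Submodule ℚ (LinearMap.BilinForm ℚ (H1Q Λ))} (hH : H ≤ H2Q Λ)
    (h0 : complexSpan H ≠ ⊥)
    (hstab : ∀ l : (E →+* ℂ) → ℂˣ, ∏ σ, l σ = 1 → ∀ φ ∈ complexSpan H,
      AlgGroup.formAction (AlgGroup.diagGL κ l) φ ∈ complexSpan H) :
    H2C Λ ≤ complexSpan H := fun χ hχ =>
  AlgGroup.mem_of_isAlt hE κ (complexSpan H) (AlgGroup.isGaloisStableSpace_span _)
    (fun _ hφ => isAlt_of_mem_complexSpan hH hφ) hstab h0 χ hχ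

end Forms

variable {V : Type*} [NormedAddCommGroup V] [NormedSpace ℂ V] [FiniteDimensional ℂ V]
variable (Λ : Submodule ℤ V) [DiscreteTopology Λ] [IsZLattice ℝ Λ]
variable {E : Type*} [Field E] [NumberField E]

theorem ne_zero_of_eq_one_or_neg_one {n : (E →+* ℂ) → ℤ} (hn : ∀ σ, n σ = 1 ∨ n σ = -1) :
    n ≠ 0 := by
  rintro rfl
  obtain ⟨σ⟩ : Nonempty (E →+* ℂ) := inferInstance
  simpa using hn σ

theorem hodgeGroup_eq_normOneTorus (hE : IsDoublyTransitiveField E) (κ : H1Q Λ ≃ₗ[ℚ] E)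
    (ρ : E →ₐ[ℚ] Module.End ℚ (H1Q Λ)) (hκ : ∀ a w, κ (ρ a w) = a * κ w)
    (hρ : ∀ a, ρ a ∈ endAlgebra Λ) : hodgeGroup Λ = AlgGroup.normOneTorus ρ := by
  obtain ⟨n, hsum, hn, hz⟩ := exists_hodge_cocharacter Λ κ ρ hκ hρ
  have hn0 : n ≠ 0 := ne_zero_of_eq_one_or_neg_one fun σ => (hn σ).imp And.left And.left
  refine le_antisymm (sInf_le ⟨AlgGroup.isAlgebraicOverQ_normOneTorus κ ρ hκ, fun z h => ?_⟩)
    (le_sInf fun G hG => ?_)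
  · rw [hz z h]
    exact (AlgGroup.mem_normOneTorus_iff κ ρ hκ _).2
      ⟨_, rfl, by rw [← AlgGroup.zpow_sum, hsum, zpow_zero]⟩
  · refine AlgGroup.normOneTorus_le hE κ ρ hκ G hG.1.isGaloisStable n hn0 hsum
      (hG.1.mem_cocharacters κ n fun z h => ?_)
    rw [← hz z h]
    exact hG.2 z h

variable {Λ}

theorem isSimpleOnH2_normOneTorus (hE : IsDoublyTransitiveField E) (κ : H1Q Λ ≃ₗ[ℚ] E)
    (ρ : E →ₐ[ℚ] Module.End ℚ (H1Q Λ)) (hκ : ∀ a w, κ (ρ a w) = a * κ w)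
    (h : 1 < Module.finrank ℚ (H1Q Λ)) : IsSimpleOnH2 (AlgGroup.normOneTorus ρ) := by
  refine ⟨H2Q_ne_bot h, fun H hH hstab => or_iff_not_imp_left.2 fun h0 => le_antisymm hH ?_⟩
  intro B hB
  refine AlgGroup.mem_of_baseChange_mem H B
    (H2C_le_complexSpan hE κ hH (complexSpan_ne_bot h0) (fun l hl φ hφ => ?_) ?_)
  · exact hstab _ ((AlgGroup.mem_normOneTorus_iff κ ρ hκ _).2 ⟨l, rfl, hl⟩) φ hφ
  · exact isAlt_of_mem_complexSpan le_rfl (Submodule.subset_span (Set.mem_image_of_mem _ hB))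

theorem isTwoSimple_of_doublyTransitive (hE : IsDoublyTransitiveField E) (κ : H1Q Λ ≃ₗ[ℚ] E)
    (ρ : E →ₐ[ℚ] Module.End ℚ (H1Q Λ)) (hκ : ∀ a w, κ (ρ a w) = a * κ w)
    (hρ : ∀ a, ρ a ∈ endAlgebra Λ) (h : 2 ≤ Module.finrank ℂ V) : IsTwoSimple Λ := by
  refine ⟨h, fun H ⟨hH, hdec⟩ hne => ?_⟩
  have h0 : complexSpan H ≠ ⊥ := fun hbot => hne (by rw [hbot, bot_inf_eq])
  obtain ⟨n, hsum, hn, -⟩ := exists_hodge_cocharacter Λ κ ρ hκ hρ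
  have hn0 : n ≠ 0 := ne_zero_of_eq_one_or_neg_one fun σ => (hn σ).imp And.left And.left
  have heigen (z : ℂˣ) (φ : LinearMap.BilinForm ℂ (H1C Λ)) (hφ : φ ∈ complexSpan H) :
      AlgGroup.formAction (AlgGroup.diagGL κ fun σ => z ^ n σ) φ ∈ complexSpan H := by
    have hsmul (φ : LinearMap.BilinForm ℂ (H1C Λ)) (hφ : φ ∈ complexSpan H) (c : ℂ)
        (hc : ∀ σ τ, ((z ^ n σ : ℂˣ) : ℂ)⁻¹ * ((z ^ n τ : ℂˣ) : ℂ)⁻¹ = c ∨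
          φ (AlgGroup.eigenbasis κ σ) (AlgGroup.eigenbasis κ τ) = 0) :
        AlgGroup.formAction (AlgGroup.diagGL κ fun σ => z ^ n σ) φ ∈ complexSpan H := by
      have : AlgGroup.formAction (AlgGroup.diagGL κ fun σ => z ^ n σ) φ = c • φ := by
        refine (AlgGroup.eigenbasis κ).ext fun σ => (AlgGroup.eigenbasis κ).ext fun τ => ?_
        rw [AlgGroup.formAction_diagGL, LinearMap.smul_apply, LinearMap.smul_apply, smul_eq_mul]
        rcases hc σ τ with hc | hc <;> rw [hc]
        simp
      rw [this]
      exact Submodule.smul_mem _ c hφ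
    have hz0 : (z : ℂ) ≠ 0 := z.ne_zero
    have hadd (φ ψ : LinearMap.BilinForm ℂ (H1C Λ)) (u : AlgGroup.GLC (H1Q Λ)) :
        AlgGroup.formAction u (φ + ψ) = AlgGroup.formAction u φ + AlgGroup.formAction u ψ := rfl
    rw [hdec] at hφ
    obtain ⟨φ₁, hφ₁, φ₂, hφ₂, rfl⟩ := Submodule.mem_sup.1 hφ
    obtain ⟨φ₃, hφ₃, φ₄, hφ₄, rfl⟩ := Submodule.mem_sup.1 hφ₁
    rw [hadd, hadd]
    refine add_mem (add_mem ?_ ?_) ?_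
    · refine hsmul φ₃ hφ₃.1 ((z : ℂ)⁻¹ * (z : ℂ)⁻¹) fun σ τ => ?_
      have halt : φ₃.IsAlt := hφ₃.2.1
      rcases hn σ with ⟨h1, -⟩ | ⟨-, h1⟩
      · rcases hn τ with ⟨h2, -⟩ | ⟨-, h2⟩
        · left; simp [h1, h2]
        · right
          rw [← halt.neg_eq, hφ₃.2.2 _ h2 _ trivial, neg_zero]
      · exact Or.inr (hφ₃.2.2 _ h1 _ trivial)
    · refine hsmul φ₄ hφ₄.1 1 fun σ τ => ?_
      rcases hn σ with ⟨h1, h1'⟩ | ⟨h1, h1'⟩ <;> rcases hn τ with ⟨h2, h2'⟩ | ⟨h2, h2'⟩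
      · exact Or.inr (hφ₄.2.1.2 _ h1' _ h2')
      · left; simp [h1, h2, hz0]
      · left; simp [h1, h2, hz0]
      · exact Or.inr (hφ₄.2.2.2 _ h1' _ h2')
    · refine hsmul φ₂ hφ₂.1 ((z : ℂ) * (z : ℂ)) fun σ τ => ?_
      have halt : φ₂.IsAlt := hφ₂.2.1
      rcases hn σ with ⟨-, h1⟩ | ⟨h1, -⟩
      · exact Or.inr (hφ₂.2.2 _ h1 _ trivial)
      · rcases hn τ with ⟨-, h2⟩ | ⟨h2, -⟩
        · right
          rw [← halt.neg_eq, hφ₂.2.2 _ h2 _ trivial, neg_zero]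
        · left; simp [h1, h2]
  have hcochar : n ∈ AlgGroup.cocharacters κ (AlgGroup.formStabilizer (complexSpan H)) := by
    refine fun z φ => ⟨fun hφ => ?_, heigen z φ⟩
    have hinv := heigen z⁻¹ _ hφ
    rw [← AlgGroup.formAction_mul, ← map_mul] at hinv
    have : ((fun σ => z⁻¹ ^ n σ) * fun σ => z ^ n σ : (E →+* ℂ) → ℂˣ) = 1 := by
      funext σ
      simp
    rwa [this, map_one, AlgGroup.formAction_one] at hinv
  have hle : H20 Λ ≤ H2C Λ := fun φ hφ => hφ.1
  refine hle.trans (H2C_le_complexSpan hE κ hH h0 fun l hl φ hφ => ?_)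
  exact (AlgGroup.diagGL_mem_of_mem_cocharacters hE κ _
    (AlgGroup.isGaloisStable_formStabilizer (AlgGroup.isGaloisStableSpace_span _)) n hn0 hsum
    hcochar l hl φ).2 hφ

end ComplexTorus

end

theorem mainTheorem7 {V : Type*} [NormedAddCommGroup V] [NormedSpace ℂ V] [FiniteDimensional ℂ V]
    (Λ : Submodule ℤ V) [DiscreteTopology Λ] [IsZLattice ℝ Λ]
    (g : ℕ) (hdim : Module.finrank ℂ V = g) (hg : 2 < g)
    (hsimple : ComplexTorus.IsSimple Λ)
    {E : Type*} [Field E] [NumberField E]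
    (e : E ≃ₐ[ℚ] ComplexTorus.endAlgebra Λ)
    (hdeg : Module.finrank ℚ E = 2 * g)
    (hE : IsDoublyTransitiveField E) :
    (ComplexTorus.hodgeGroup Λ =
        AlgGroup.normOneTorus ((ComplexTorus.endAlgebra Λ).val.comp e.toAlgHom) ∧
      AlgGroup.IsSimpleQTorus (ComplexTorus.hodgeGroup Λ) ∧
      AlgGroup.IsQTorusOfDim (ComplexTorus.hodgeGroup Λ) (2 * g - 1)) ∧
    (ComplexTorus.IsSimpleOnH2 (ComplexTorus.hodgeGroup Λ) ∧
      ComplexTorus.IsTwoSimple Λ) := by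
  have hrank : Module.finrank ℚ (ComplexTorus.H1Q Λ) = 2 * g := by
    rw [ComplexTorus.finrank_H1Q, hdim]
  obtain ⟨κ, hκ⟩ := AlgGroup.exists_equivariant_equiv (hrank.trans hdeg.symm)
    ((ComplexTorus.endAlgebra Λ).val.comp e.toAlgHom)
  have hρ (a : E) : (ComplexTorus.endAlgebra Λ).val.comp e.toAlgHom a ∈ ComplexTorus.endAlgebra Λ :=
    (e a).2
  have hHdg := ComplexTorus.hodgeGroup_eq_normOneTorus Λ hE κ _ hκ hρ
  refine ⟨⟨hHdg, ?_, ?_⟩, ?_, ?_⟩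
  · rw [hHdg]
    exact AlgGroup.isSimpleQTorus_normOneTorus hE κ _ hκ (by omega)
  · rw [hHdg]
    exact ⟨AlgGroup.isAlgebraicOverQ_normOneTorus κ _ hκ,
      AlgGroup.isTorusOfDim_normOneTorus κ _ hκ _ (by omega)⟩
  · rw [hHdg]
    exact ComplexTorus.isSimpleOnH2_normOneTorus hE κ _ hκ (by omega)
  · exact ComplexTorus.isTwoSimple_of_doublyTransitive hE κ _ hκ hρ (by omega)
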